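/- Let $K$ be a field of characteristic zero and let $n \ge 3$. Let $\mathrm{GA}_n(K)$ be the group of polynomial automorphisms of affine $n$-space $\mathbb{A}^n_K$ over $K$, under composition; an automorphism $\varphi$ is written $(F_1,\dots,F_n)$, where $F_i = (x_i)\varphi \in K[x_1,\dots,x_n]$ is the image of $x_i$ under the corresponding $K$-algebra automorphism of $K[x_1,\dots,x_n]$. Call $\varphi$ *affine* if every component $F_i$ has degree one, and let $\mathrm{Aff}_n(K)$ be the subgroup of affine automorphisms. Call $\varphi$ *triangular* if, for every $i$, $F_i = u_i x_i + P_i$ with $u_i \in K^*$ and $P_i \in K[x_1,\dots,x_{i-1}]$, and let $\mathrm{TA}_n(K)$ be the subgroup of $\mathrm{GA}_n(K)$ generated by all affine and all triangular automorphisms. Call $\varphi$ *co-tame* if $\mathrm{TA}_n(K) \subseteq \langle \varphi, \mathrm{Aff}_n(K)\rangle$, and *3-triangular* if $\varphi = \alpha_0\tau_1\alpha_1\tau_2\alpha_2\tau_3\alpha_3$ with all $\alpha_i$ affine and all $\tau_i$ triangular. Then every 3-triangular automorphism $\varphi \in \mathrm{GA}_n(K)$ is affine or co-tame. -/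

import Mathlib

/-- The group `GA_n(K)` of polynomial automorphisms of affine `n`-space over `K`: an automorphism
`φ` is given by its comorphism `P ↦ (P)φ` of `K[x_1, …, x_n]`. The multiplicative opposite makes
the product the composition of maps of affine space, that is, `(P)(φψ) = ((P)φ)ψ`. -/
abbrev GA (n : ℕ) (K : Type*) [Field K] : Type _ :=
  (MvPolynomial (Fin n) K ≃ₐ[K] MvPolynomial (Fin n) K)ᵐᵒᵖ

namespace GA

variable {n : ℕ} {K : Type*} [Field K]

/-- The `i`-th component `(x_i)φ`, so that `φ = (φ.component 0, …, φ.component (n - 1))`. -/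
noncomputable def component (φ : GA n K) (i : Fin n) : MvPolynomial (Fin n) K :=
  φ.unop (MvPolynomial.X i)

/-- An automorphism is affine if all its components have degree one. -/
def IsAffine (φ : GA n K) : Prop :=
  ∀ i, (φ.component i).totalDegree = 1

/-- An automorphism is (lower) triangular if its `i`-th component is `u_i x_i + P_i` with
`u_i` a unit of `K` and `P_i` a polynomial in the variables `x_j`, `j < i`, only. -/
def IsTriangular (φ : GA n K) : Prop :=
  ∀ i, ∃ u : Kˣ, ∃ P ∈ MvPolynomial.supported K (Set.Iio i),
    φ.component i = MvPolynomial.C (u : K) * MvPolynomial.X i + P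

/-- `φ` is `m`-triangular if `φ = α_0 τ_1 α_1 τ_2 α_2 ⋯ τ_m α_m` with every `α_i` affine and every
`τ_i` triangular. -/
def IsMTriangular (m : ℕ) (φ : GA n K) : Prop :=
  ∃ (α : Fin (m + 1) → GA n K) (τ : Fin m → GA n K),
    (∀ i, (α i).IsAffine) ∧ (∀ i, (τ i).IsTriangular) ∧
      φ = α 0 * (List.ofFn fun i : Fin m => τ i * α i.succ).prod

variable (n K) in
/-- The tame subgroup `TA_n(K)`, generated by the affine and the triangular automorphisms. -/
noncomputable def tame : Subgroup (GA n K) :=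
  Subgroup.closure ({α | α.IsAffine} ∪ {τ | τ.IsTriangular})

/-- `φ` is co-tame if the subgroup generated by `φ` and the affine automorphisms contains the
tame subgroup. -/
def IsCotame (φ : GA n K) : Prop :=
  tame n K ≤ Subgroup.closure (insert φ {α | α.IsAffine})

end GA

/-! Let `H` be the group generated by `φ` and the affine automorphisms. There are two cases.

If `H` contains a nonaffine elementary automorphism `x_z ↦ x_z + h`, then it contains every
triangular automorphism (`isTri_mem_of_elem_mem`). Conjugation by diagonal automorphisms isolates a
monomial of `h`, affine substitutions reduce it to some `x_i x_j`, and conjugation among quadratic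
and higher elementary automorphisms rebuilds all monomials. This uses characteristic zero and a
third variable.

Otherwise every elementary element of `H` is affine, and `φ` turns out to be affine. The main tool
is `isAff_of_isAff_conj_trans`: an element of `H` that conjugates one nontrivial translation to an
affine automorphism `A` is itself affine. If `A` is a translation, the element commutes with a
translation up to affine factors, and `isAff_of_commute_elem` applies. If `A` is not a translation,
there is a contradiction. By `not_isAff_conj_elem`, conjugating `x_z ↦ x_z + h` with `h` nonconstant
gives something nonaffine. On the other hand `false_of_map_invariant` shows that it must be affine
as soon as `h` is an affine invariant of the source translation whose image is invariant under a
translation commuting with `A`. Such an `h` is found in `false_of_invariant_affine` when `A` has a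
nonconstant affine invariant. When it has none, `A` is a single Jordan block on affine functions, an
orbit is a moment curve, and a dilation of that curve yields `h` (`false_of_invariants_const`).

Up to affine factors at the ends, a 3-triangular `φ` is `ψ = τ₁ α₁ τ₂ α₂ τ₃` as a product of algebra
automorphisms. A suitable translation passes through `τ₃` and `α₂` as a translation, and `τ₂` turns
it into a unitriangular `σ`. Iterated commutators of `σ` with a translation become trivial. Applying
the tool along this chain of commutators, and finally to `ψ`, proves affineness
(`isAff_of_three_triangular`). -/

namespace PolyAut

open MvPolynomial

section

/-! ### Surjective endomorphisms of Noetherian rings -/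

/-- The kernels of the powers of `f` stabilise at some `N`. Writing an element of the kernel as `f^N
y` puts `y` in the kernel of `f^(N+1)`, hence in that of `f^N`. This makes surjective substitutions
into automorphisms. -/
theorem injective_of_surjective_ringEnd {A : Type*} [CommRing A] [IsNoetherianRing A]
    (f : A →+* A) (hf : Function.Surjective f) : Function.Injective f := by
  have hmono : Monotone fun k : ℕ => RingHom.ker (f ^ k) := by
    refine monotone_nat_of_le_succ fun k x hx => ?_
    rw [RingHom.mem_ker] at hx ⊢
    rw [pow_succ', RingHom.mul_def, RingHom.comp_apply, hx, map_zero]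
  obtain ⟨N, hN⟩ := monotone_stabilizes_iff_noetherian.mpr
    (inferInstance : IsNoetherian A A) ⟨_, hmono⟩
  rw [injective_iff_map_eq_zero]
  intro x hx
  have hsurj : ∀ k : ℕ, Function.Surjective (f ^ k : A →+* A) := fun k => by
    rw [RingHom.coe_pow]
    exact hf.iterate k
  obtain ⟨y, rfl⟩ := hsurj N x
  have hy : y ∈ RingHom.ker (f ^ (N + 1)) := by
    rw [RingHom.mem_ker, pow_succ', RingHom.mul_def, RingHom.comp_apply, hx]
  have h2 := hN (N + 1) (Nat.le_succ N)
  simp only [OrderHom.coe_mk] at h2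
  rw [← h2, RingHom.mem_ker] at hy
  exact hy

variable {n : ℕ} {K : Type*} [Field K]

variable (n K) in
/-- The group of automorphisms of the polynomial algebra. -/
abbrev Aut : Type _ := MvPolynomial (Fin n) K ≃ₐ[K] MvPolynomial (Fin n) K

/-! ### Polynomials of degree at most one -/

variable (n K) in
/-- The space of polynomials of total degree at most one. -/
noncomputable abbrev affineFns : Submodule K (MvPolynomial (Fin n) K) :=
  restrictTotalDegree (Fin n) K 1

theorem C_mem_affineFns (c : K) : (C c : MvPolynomial (Fin n) K) ∈ affineFns n K := by
  simp [mem_restrictTotalDegree]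

theorem one_mem_affineFns : (1 : MvPolynomial (Fin n) K) ∈ affineFns n K := by
  simp [mem_restrictTotalDegree]

theorem X_mem_affineFns (i : Fin n) : (X i : MvPolynomial (Fin n) K) ∈ affineFns n K := by
  simp [mem_restrictTotalDegree]

theorem C_mul_X_mem_affineFns (c : K) (i : Fin n) :
    (C c * X i : MvPolynomial (Fin n) K) ∈ affineFns n K := by
  rw [C_mul']
  exact Submodule.smul_mem _ _ (X_mem_affineFns i)

variable (n K) in
theorem affineFns_eq_span :
    affineFns n K = Submodule.span K (insert 1 (Set.range X)) := by
  apply le_antisymm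
  · rw [affineFns, restrictTotalDegree, restrictSupport_eq_span, Submodule.span_le]
    rintro _ ⟨m, hm, rfl⟩
    simp only [Set.mem_ofPred_eq] at hm
    apply Submodule.subset_span
    rcases Nat.le_one_iff_eq_zero_or_eq_one.mp hm with h | h
    · left
      have : m = 0 := by
        ext i
        by_contra hi
        have hi' : m i ≠ 0 := hi
        have := Finset.single_le_sum (f := fun i => m i) (fun _ _ => Nat.zero_le _)
          (Finsupp.mem_support_iff.mpr hi')
        simp only [Finsupp.sum] at h
        omega
      simp [this]
    · right
      obtain ⟨i, hi⟩ := (Finsupp.sum_eq_one_iff m).mp h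
      exact ⟨i, by simp [X, ← hi]⟩
  · rw [Submodule.span_le]
    rintro _ (rfl | ⟨i, rfl⟩)
    · exact one_mem_affineFns
    · exact X_mem_affineFns i

/-- Two linear maps that agree on `1` and on the variables agree on the affine functions. -/
theorem eqOn_affineFns {M : Type*} [AddCommGroup M] [Module K M]
    {f g : MvPolynomial (Fin n) K →ₗ[K] M} (h1 : f 1 = g 1) (hX : ∀ i, f (X i) = g (X i))
    {P : MvPolynomial (Fin n) K} (hP : P ∈ affineFns n K) : f P = g P := by
  rw [affineFns_eq_span] at hP
  refine LinearMap.eqOn_span ?_ hP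
  rintro _ (rfl | ⟨i, rfl⟩)
  exacts [h1, hX i]

theorem map_affineFns_mem {M : Type*} [AddCommGroup M] [Module K M]
    {f : MvPolynomial (Fin n) K →ₗ[K] M} {N : Submodule K M} (h1 : f 1 ∈ N)
    (hX : ∀ i, f (X i) ∈ N) {P : MvPolynomial (Fin n) K} (hP : P ∈ affineFns n K) : f P ∈ N := by
  rw [affineFns_eq_span] at hP
  have : Submodule.span K (insert 1 (Set.range X)) ≤ N.comap f := by
    rw [Submodule.span_le]
    rintro _ (rfl | ⟨i, rfl⟩)
    exacts [h1, hX i]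
  exact this hP

theorem totalDegree_ne_zero {P : MvPolynomial (Fin n) K} (hP : ∀ c, P ≠ C c) :
    P.totalDegree ≠ 0 := fun h => hP _ (totalDegree_eq_zero_iff_eq_C.mp h)

theorem mul_notMem_affineFns {P Q : MvPolynomial (Fin n) K} (hP : ∀ c, P ≠ C c)
    (hQ : ∀ c, Q ≠ C c) : P * Q ∉ affineFns n K := by
  rw [mem_restrictTotalDegree, totalDegree_mul_of_isDomain]
  · have := totalDegree_ne_zero hP
    have := totalDegree_ne_zero hQ
    omega
  · exact fun h => hP 0 (by simpa using h)
  · exact fun h => hQ 0 (by simpa using h)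

/-! ### Affine automorphisms -/

/-- An automorphism is affine if it maps the variables to polynomials of degree at most one. -/
def IsAff (φ : Aut n K) : Prop :=
  ∀ i, φ (X i) ∈ affineFns n K

theorem IsAff.map_mem {φ : Aut n K} (h : IsAff φ)
    {P : MvPolynomial (Fin n) K} (hP : P ∈ affineFns n K) : φ P ∈ affineFns n K :=
  map_affineFns_mem (f := φ.toLinearMap) (by simpa using one_mem_affineFns) h hP

theorem isAff_one : IsAff (1 : Aut n K) :=
  fun i => X_mem_affineFns i

theorem IsAff.mul {φ ψ : Aut n K} (h : IsAff φ)
    (h' : IsAff ψ) : IsAff (φ * ψ) := fun i => h.map_mem (h' i)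

/-- The affine functions form a finite-dimensional space, so an injective endomorphism of it is
onto. -/
theorem IsAff.inv {φ : Aut n K} (h : IsAff φ) :
    IsAff φ⁻¹ := by
  intro i
  let f : affineFns n K →ₗ[K] affineFns n K :=
    φ.toLinearMap.restrict fun P hP => h.map_mem hP
  have hf : Function.Injective f := fun P Q hPQ => by
    have : φ P = φ Q := congrArg Subtype.val hPQ
    exact Subtype.ext (φ.injective this)
  obtain ⟨P, hP⟩ := LinearMap.injective_iff_surjective.mp hf ⟨X i, X_mem_affineFns i⟩
  have hP' : φ P = X i := congrArg Subtype.val hP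
  rw [← hP', ← AlgEquiv.mul_apply, inv_mul_cancel]
  exact P.2

theorem IsAff.mul_right_iff {φ ψ : Aut n K}
    (h : IsAff ψ) : IsAff (φ * ψ) ↔ IsAff φ :=
  ⟨fun h' => by simpa using h'.mul h.inv, fun h' => h'.mul h⟩

theorem IsAff.mul_left_iff {φ ψ : Aut n K}
    (h : IsAff φ) : IsAff (φ * ψ) ↔ IsAff ψ :=
  ⟨fun h' => by simpa [← mul_assoc] using h.inv.mul h', fun h' => h.mul h'⟩

theorem map_eq_C_iff (φ : Aut n K)
    {P : MvPolynomial (Fin n) K} {c : K} : φ P = C c ↔ P = C c := by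
  have h : φ (C c) = C c := φ.commutes c
  exact ⟨fun hP => φ.injective (hP.trans h.symm), fun hP => by rw [hP, h]⟩

/-- Affine functions that generate all affine functions are the components of an
automorphism. -/
theorem exists_algEquiv_of_span (ℓ : Fin n → MvPolynomial (Fin n) K)
    (hX : ∀ j, X j ∈ Submodule.span K (insert 1 (Set.range ℓ))) :
    ∃ φ : Aut n K, ∀ i, φ (X i) = ℓ i := by
  have hsurj : Function.Surjective (aeval ℓ : MvPolynomial (Fin n) K →ₐ[K] _) := by
    rw [← AlgHom.range_eq_top, eq_top_iff, ← adjoin_range_X, Algebra.adjoin_le_iff]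
    rintro _ ⟨j, rfl⟩
    have : Submodule.span K (insert 1 (Set.range ℓ)) ≤
        (aeval ℓ : MvPolynomial (Fin n) K →ₐ[K] MvPolynomial (Fin n) K).range.toSubmodule := by
      rw [Submodule.span_le]
      rintro _ (rfl | ⟨i, rfl⟩)
      · exact ⟨1, by simp⟩
      · exact ⟨X i, by simp⟩
    exact this (hX j)
  have hinj := injective_of_surjective_ringEnd
    (aeval ℓ : MvPolynomial (Fin n) K →ₐ[K] MvPolynomial (Fin n) K).toRingHom hsurj
  exact ⟨AlgEquiv.ofBijective (aeval ℓ) ⟨hinj, hsurj⟩, fun i => by simp⟩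

/-! ### Locally nilpotent differences -/

section Nilpotent

variable {A : Type*} [CommRing A] [Algebra K A]

/-- The difference operator `P ↦ t P - P`. -/
noncomputable def diff (t : A ≃ₐ[K] A) : Module.End K A := t.toLinearMap - 1

@[simp] theorem diff_apply (t : A ≃ₐ[K] A) (P : A) : diff t P = t P - P := rfl

theorem diff_eq_zero {t : A ≃ₐ[K] A} {P : A} : diff t P = 0 ↔ t P = P := sub_eq_zero

/-- The twisted Leibniz rule `δ(PQ) = δP Q + P δQ + δP δQ` lowers the total nilpotency order of each
term, so induction on `a + b` works as for a derivation. -/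
theorem diff_pow_mul (t : A ≃ₐ[K] A) : ∀ (m a b : ℕ), m = a + b → ∀ P Q : A,
    (diff t ^ a) P = 0 → (diff t ^ b) Q = 0 → (diff t ^ m) (P * Q) = 0 := by
  intro m
  induction m with
  | zero =>
    intro a b h P Q hP hQ
    obtain ⟨rfl, rfl⟩ : a = 0 ∧ b = 0 := by omega
    simp only [pow_zero, Module.End.one_apply] at hP ⊢
    simp [hP]
  | succ m ih =>
    have key : ∀ (j : ℕ) (P : A), (diff t ^ (j + 1)) P = 0 → (diff t ^ j) (diff t P) = 0 := by
      intro j P h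
      rwa [pow_succ, Module.End.mul_apply] at h
    intro a b h P Q hP hQ
    rcases a with _ | a
    · simp only [pow_zero, Module.End.one_apply] at hP
      simp [hP]
    rcases b with _ | b
    · simp only [pow_zero, Module.End.one_apply] at hQ
      simp [hQ]
    have e : diff t (P * Q) = diff t P * Q + P * diff t Q + diff t P * diff t Q := by
      simp only [diff_apply, map_mul]
      ring
    rw [pow_succ, Module.End.mul_apply, e, map_add, map_add,
      ih a (b + 1) (by omega) _ _ (key _ _ hP) hQ, ih (a + 1) b (by omega) _ _ hP (key _ _ hQ)]
    have h3 : (diff t ^ (a + 1)) (diff t P) = 0 := by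
      rw [pow_succ', Module.End.mul_apply, key _ _ hP, map_zero]
    rw [ih (a + 1) b (by omega) _ _ h3 (key _ _ hQ)]
    simp

theorem diff_pow_mono (t : A ≃ₐ[K] A) {a b : ℕ} (h : a ≤ b) {P : A} (hP : (diff t ^ a) P = 0) :
    (diff t ^ b) P = 0 := by
  obtain ⟨c, rfl⟩ := Nat.exists_eq_add_of_le' h
  rw [pow_add, Module.End.mul_apply, hP, map_zero]

theorem exists_diff_pow_eq_zero (t : Aut n K)
    (h : ∀ i, ∃ k, (diff t ^ k) (X i) = 0) (P : MvPolynomial (Fin n) K) :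
    ∃ k, (diff t ^ k) P = 0 := by
  induction P using MvPolynomial.induction_on with
  | C a => exact ⟨1, by simpa [sub_eq_zero] using t.commutes a⟩
  | add P Q hP hQ =>
    obtain ⟨a, ha⟩ := hP
    obtain ⟨b, hb⟩ := hQ
    exact ⟨max a b, by rw [map_add, diff_pow_mono t (le_max_left a b) ha,
      diff_pow_mono t (le_max_right a b) hb, add_zero]⟩
  | mul_X P i hP =>
    obtain ⟨a, ha⟩ := hP
    obtain ⟨b, hb⟩ := h i
    exact ⟨a + b, diff_pow_mul t _ _ _ rfl _ _ ha hb⟩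

theorem diff_conj_pow (φ t : A ≃ₐ[K] A) (k : ℕ) (P : A) :
    (diff (φ * t * φ⁻¹) ^ k) P = φ ((diff t ^ k) (φ⁻¹ P)) := by
  induction k generalizing P with
  | zero => simp
  | succ k ih =>
    rw [pow_succ, Module.End.mul_apply, ih, pow_succ, Module.End.mul_apply]
    congr 2
    simp [AlgEquiv.mul_apply]

end Nilpotent

/-- A locally nilpotent operator pushes an element outside a set containing `0` to a last
position outside of this set. -/
theorem exists_last_notMem {M : Type*} (δ : M → M) (S : Set M) {x : M} (hx : x ∉ S)
    (h : ∃ k, δ^[k] x ∈ S) : ∃ k, δ^[k] x ∉ S ∧ δ^[k + 1] x ∈ S := by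
  classical
  have h0 : Nat.find h ≠ 0 := by
    intro h0
    have := Nat.find_spec h
    rw [h0] at this
    exact hx this
  obtain ⟨k, hk⟩ := Nat.exists_eq_succ_of_ne_zero h0
  exact ⟨k, Nat.find_min h (by omega), by have := Nat.find_spec h; rwa [hk] at this⟩

end

section

variable {n : ℕ} {K : Type*} [Field K]

/-! ### Elementary automorphisms -/

variable (K) in
/-- The polynomials that do not involve the variable `x_z`. -/
noncomputable abbrev without (z : Fin n) : Subalgebra K (MvPolynomial (Fin n) K) :=
  supported K {z}ᶜ

theorem X_mem_without {i z : Fin n} (h : i ≠ z) :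
    (X i : MvPolynomial (Fin n) K) ∈ without K z := X_mem_supported.mpr h

theorem map_supported_mem {B : Type*} [CommRing B] [Algebra K B] {s : Set (Fin n)}
    (f : MvPolynomial (Fin n) K →ₐ[K] B) (S : Subalgebra K B) (h : ∀ i ∈ s, f (X i) ∈ S)
    {P : MvPolynomial (Fin n) K} (hP : P ∈ supported K s) : f P ∈ S := by
  have : supported K s ≤ S.comap f := by
    rw [supported_eq_adjoin_X, Algebra.adjoin_le_iff]
    rintro _ ⟨i, hi, rfl⟩
    exact h i hi
  exact this hP

theorem eqOn_supported {B : Type*} [CommRing B] [Algebra K B] {s : Set (Fin n)}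
    (f g : MvPolynomial (Fin n) K →ₐ[K] B) (h : ∀ i ∈ s, f (X i) = g (X i))
    {P : MvPolynomial (Fin n) K} (hP : P ∈ supported K s) : f P = g P := by
  have : supported K s ≤ AlgHom.equalizer f g := by
    rw [supported_eq_adjoin_X, Algebra.adjoin_le_iff]
    rintro _ ⟨i, hi, rfl⟩
    exact h i hi
  exact this hP

theorem algEquiv_ext {B : Type*} [CommRing B] [Algebra K B]
    {φ ψ : MvPolynomial (Fin n) K ≃ₐ[K] B}
    (h : ∀ i, φ (X i) = ψ (X i)) : φ = ψ := by
  have : (φ : MvPolynomial (Fin n) K →ₐ[K] B) = ψ := MvPolynomial.algHom_ext h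
  exact AlgEquiv.ext fun P => DFunLike.congr_fun this P

/-- The endomorphism that adds `h` to the variable `x_z`. -/
noncomputable def elemHom (z : Fin n) (h : MvPolynomial (Fin n) K) :
    MvPolynomial (Fin n) K →ₐ[K] MvPolynomial (Fin n) K :=
  aeval (Function.update X z (X z + h))

theorem elemHom_X_self (z : Fin n) (h : MvPolynomial (Fin n) K) :
    elemHom z h (X z) = X z + h := by
  simp [elemHom]

theorem elemHom_X_of_ne {i z : Fin n} (hi : i ≠ z) (h : MvPolynomial (Fin n) K) :
    elemHom z h (X i) = X i := by
  simp [elemHom, hi]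

theorem elemHom_of_mem (z : Fin n) (h : MvPolynomial (Fin n) K) {P : MvPolynomial (Fin n) K}
    (hP : P ∈ without K z) : elemHom z h P = P :=
  eqOn_supported (elemHom z h) (AlgHom.id K _) (fun _ hi => elemHom_X_of_ne hi h) hP

theorem elemHom_comp (z : Fin n) (h g : without K z) :
    (elemHom z (h : MvPolynomial (Fin n) K)).comp (elemHom z g) = elemHom z (h + g) := by
  refine MvPolynomial.algHom_ext fun i => ?_
  rw [AlgHom.comp_apply]
  rcases eq_or_ne i z with rfl | hi
  · rw [elemHom_X_self, elemHom_X_self, map_add, elemHom_X_self, elemHom_of_mem _ _ g.2,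
      Subalgebra.coe_add]
    ring
  · rw [elemHom_X_of_ne hi, elemHom_X_of_ne hi, elemHom_X_of_ne hi]

theorem elemHom_zero (z : Fin n) : elemHom z (0 : MvPolynomial (Fin n) K) = AlgHom.id K _ := by
  refine MvPolynomial.algHom_ext fun i => ?_
  rcases eq_or_ne i z with rfl | hi
  · simp [elemHom_X_self]
  · simp [elemHom_X_of_ne hi]

/-- The elementary automorphism that adds `h`, which does not involve `x_z`, to the
variable `x_z`. -/
noncomputable def elem (z : Fin n) (h : without K z) :
    Aut n K :=
  AlgEquiv.ofAlgHom (elemHom z h) (elemHom z (-h : without K z))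
    (by rw [elemHom_comp, ← elemHom_zero z]; congr 1; simp)
    (by rw [elemHom_comp, ← elemHom_zero z]; congr 1; simp)

@[simp] theorem elem_X_self (z : Fin n) (h : without K z) :
    elem z h (X z) = X z + (h : MvPolynomial (Fin n) K) :=
  elemHom_X_self z _

theorem elem_X_of_ne {i z : Fin n} (hi : i ≠ z) (h : without K z) : elem z h (X i) = X i :=
  elemHom_X_of_ne hi _

theorem elem_of_mem {z : Fin n} (h : without K z) {P : MvPolynomial (Fin n) K}
    (hP : P ∈ without K z) : elem z h P = P := elemHom_of_mem z _ hP

theorem elem_add (z : Fin n) (h g : without K z) : elem z (h + g) = elem z h * elem z g :=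
  AlgEquiv.ext fun P => DFunLike.congr_fun (elemHom_comp z h g).symm P

theorem elem_zero (z : Fin n) : elem z (0 : without K z) = 1 :=
  AlgEquiv.ext fun P => DFunLike.congr_fun (elemHom_zero z) P

theorem isAff_elem_iff (z : Fin n) (h : without K z) :
    IsAff (elem z h) ↔ (h : MvPolynomial (Fin n) K) ∈ affineFns n K := by
  constructor
  · intro H
    have := H z
    rw [elem_X_self] at this
    simpa using Submodule.sub_mem _ this (X_mem_affineFns z)
  · intro H i
    rcases eq_or_ne i z with rfl | hi
    · rw [elem_X_self]
      exact Submodule.add_mem _ (X_mem_affineFns i) H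
    · rw [elem_X_of_ne hi]
      exact X_mem_affineFns i

/-! ### Translations -/

/-- The translation by `v`. -/
noncomputable def trans (v : Fin n → K) :
    Aut n K :=
  AlgEquiv.ofAlgHom (aeval fun i => X i + C (v i)) (aeval fun i => X i - C (v i))
    (MvPolynomial.algHom_ext fun i => by simp)
    (MvPolynomial.algHom_ext fun i => by simp)

@[simp] theorem trans_X (v : Fin n → K) (i : Fin n) : trans v (X i) = X i + C (v i) := by
  simp [trans]

theorem algEquiv_C (φ : Aut n K) (c : K) :
    φ (C c) = C c := φ.commutes c

theorem isAff_trans (v : Fin n → K) : IsAff (trans v) := fun i => by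
  rw [trans_X]
  exact Submodule.add_mem _ (X_mem_affineFns i) (C_mem_affineFns _)

theorem trans_injective : Function.Injective (trans (n := n) (K := K)) := by
  intro v w h
  funext i
  have := DFunLike.congr_fun h (X i)
  simpa using this

theorem trans_zero : trans (0 : Fin n → K) = 1 := algEquiv_ext fun i => by simp

theorem elem_one_eq_trans (z : Fin n) : elem z (1 : without K z) = trans (Pi.single z 1) := by
  refine algEquiv_ext fun i => ?_
  rcases eq_or_ne i z with rfl | hi
  · simp
  · simp [elem_X_of_ne hi, hi]

theorem exists_diff_trans_pow_eq_zero (v : Fin n → K) (P : MvPolynomial (Fin n) K) :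
    ∃ k, (diff (trans v) ^ k) P = 0 :=
  exists_diff_pow_eq_zero _ (fun i => ⟨2, by simp [pow_succ, algEquiv_C]⟩) P

theorem exists_diff_conj_trans_pow_eq_zero
    (φ : Aut n K) (v : Fin n → K)
    (P : MvPolynomial (Fin n) K) : ∃ k, (diff (φ * trans v * φ⁻¹) ^ k) P = 0 := by
  obtain ⟨k, hk⟩ := exists_diff_trans_pow_eq_zero v (φ⁻¹ P)
  exact ⟨k, by rw [diff_conj_pow, hk, map_zero]⟩

/-- The linear part of an affine function in direction `v`. -/
noncomputable def dirDeriv (v : Fin n → K) : MvPolynomial (Fin n) K →ₗ[K] K :=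
  ∑ i, v i • lcoeff K (Finsupp.single i 1)

theorem dirDeriv_X (v : Fin n → K) (i : Fin n) : dirDeriv v (X i) = v i := by
  classical
  simp [dirDeriv, coeff_X, Finsupp.single_left_inj]

theorem dirDeriv_C (v : Fin n → K) (c : K) : dirDeriv v (C c : MvPolynomial (Fin n) K) = 0 := by
  classical
  simp [dirDeriv, coeff_C, eq_comm]

theorem trans_of_mem (v : Fin n → K) {P : MvPolynomial (Fin n) K} (hP : P ∈ affineFns n K) :
    trans v P = P + C (dirDeriv v P) := by
  refine eqOn_affineFns (f := (trans v).toLinearMap)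
    (g := LinearMap.id + (Algebra.linearMap K _).comp (dirDeriv v)) ?_ ?_ hP
  · have : dirDeriv v (1 : MvPolynomial (Fin n) K) = 0 := by simpa using dirDeriv_C v 1
    simp [this]
  · intro i
    simp [dirDeriv_X, MvPolynomial.algebraMap_eq]

/-- An affine automorphism conjugates translations to translations. -/
theorem IsAff.inv_mul_trans_mul {α : Aut n K}
    (h : IsAff α) (v : Fin n → K) :
    α⁻¹ * trans v * α = trans fun i => dirDeriv v (α (X i)) := by
  rw [mul_assoc, inv_mul_eq_iff_eq_mul]
  refine algEquiv_ext fun i => ?_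
  rw [AlgEquiv.mul_apply, AlgEquiv.mul_apply, trans_of_mem v (h i), trans_X, map_add, algEquiv_C]

theorem IsAff.exists_trans {α : Aut n K}
    (h : IsAff α) {v : Fin n → K} (hv : v ≠ 0) :
    ∃ w : Fin n → K, w ≠ 0 ∧ α * trans v * α⁻¹ = trans w := by
  have := h.inv.inv_mul_trans_mul v
  rw [inv_inv] at this
  refine ⟨_, ?_, this⟩
  intro h0
  rw [h0, trans_zero, mul_inv_eq_one, mul_eq_left, ← trans_zero] at this
  exact hv (trans_injective this)

/-- Every nontrivial translation is conjugate to the translation along `x_z`. -/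
theorem exists_conj_trans (z : Fin n) {v : Fin n → K} (hv : v ≠ 0) :
    ∃ l : Aut n K,
      IsAff l ∧ l⁻¹ * trans v * l = elem z 1 := by
  obtain ⟨k, hk⟩ := Function.ne_iff.mp hv
  have hk : v k ≠ 0 := hk
  let s := Equiv.swap k z
  -- New coordinates: `x_k / v_k` grows by one under the translation, and the other functions are
  -- invariant under it. The swap puts the first one at index `z`.
  let ℓ : Fin n → MvPolynomial (Fin n) K := fun i =>
    if i = z then C (v k)⁻¹ * X k else X (s i) - C (v (s i) * (v k)⁻¹) * X k
  have hz : ℓ z = C (v k)⁻¹ * X k := if_pos rfl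
  have hne : ∀ i, i ≠ z → ℓ i = X (s i) - C (v (s i) * (v k)⁻¹) * X k := fun i hi => if_neg hi
  have hXk : X k ∈ Submodule.span K (insert 1 (Set.range ℓ)) := by
    have : (X k : MvPolynomial (Fin n) K) = v k • ℓ z := by
      rw [hz, smul_eq_C_mul, ← mul_assoc, ← C_mul, mul_inv_cancel₀ hk, C_1, one_mul]
    rw [this]
    exact Submodule.smul_mem _ _ (Submodule.subset_span (Or.inr ⟨z, rfl⟩))
  obtain ⟨l, hl⟩ := exists_algEquiv_of_span ℓ fun j => by
    rcases eq_or_ne j k with rfl | hj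
    · exact hXk
    · have hs : s j ≠ z := fun h => hj (s.injective (h.trans (Equiv.swap_apply_left k z).symm))
      have : (X j : MvPolynomial (Fin n) K) = ℓ (s j) + (v j * (v k)⁻¹) • X k := by
        rw [hne _ hs, smul_eq_C_mul]
        simp [s]
      rw [this]
      exact Submodule.add_mem _ (Submodule.subset_span (Or.inr ⟨s j, rfl⟩))
        (Submodule.smul_mem _ _ hXk)
  refine ⟨l, fun i => ?_, ?_⟩
  · rw [hl]
    rcases eq_or_ne i z with rfl | hi
    · rw [hz]
      exact C_mul_X_mem_affineFns _ _
    · rw [hne i hi]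
      exact Submodule.sub_mem _ (X_mem_affineFns _) (C_mul_X_mem_affineFns _ _)
  · rw [mul_assoc, inv_mul_eq_iff_eq_mul]
    refine algEquiv_ext fun i => ?_
    rw [AlgEquiv.mul_apply, AlgEquiv.mul_apply, hl]
    rcases eq_or_ne i z with rfl | hi
    · rw [elem_X_self, map_add, hl, hz, map_mul, algEquiv_C, trans_X, mul_add, ← C_mul,
        inv_mul_cancel₀ hk]
      simp
    · rw [elem_X_of_ne hi, hl, hne i hi, map_sub, map_mul, algEquiv_C, trans_X, trans_X, mul_add,
        ← C_mul, mul_assoc, inv_mul_cancel₀ hk, mul_one]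
      ring

/-! ### Automorphisms that commute with a translation -/

section Commute

variable [CharZero K]

/-- Invariance under the unit shift gives invariance under all natural shifts. In characteristic
zero a polynomial in the shift parameter that is constant on these is constant, so the parameter may
be specialised to `-x_z`, which eliminates `x_z`. -/
theorem mem_without_of_elem_one_eq {z : Fin n} {P : MvPolynomial (Fin n) K}
    (h : elem z 1 P = P) : P ∈ without K z := by
  -- The generic shift: `x_z` goes to `x_z + t` with `t` a new variable.
  let Ψ : MvPolynomial (Fin n) K →ₐ[K] Polynomial (MvPolynomial (Fin n) K) :=
    aeval fun i => Polynomial.C (X i) + if i = z then Polynomial.X else 0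
  have hev : ∀ Q g : MvPolynomial (Fin n) K, (Ψ Q).eval g = elemHom z g Q := by
    intro Q g
    have : ((Polynomial.aeval g : Polynomial (MvPolynomial (Fin n) K) →ₐ[MvPolynomial (Fin n) K]
        MvPolynomial (Fin n) K).restrictScalars K).comp Ψ = elemHom z g := by
      refine MvPolynomial.algHom_ext fun i => ?_
      rcases eq_or_ne i z with rfl | hi
      · simp [Ψ, elemHom_X_self]
      · simp [Ψ, hi, elemHom_X_of_ne hi]
    rw [← this]
    simp [Polynomial.coe_aeval_eq_eval]
  have hm : ∀ m : ℕ, elemHom z (m : MvPolynomial (Fin n) K) P = P := by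
    intro m
    induction m with
    | zero => rw [Nat.cast_zero, elemHom_zero, AlgHom.id_apply]
    | succ m ih =>
      have := elemHom_comp z (m : without K z) 1
      push_cast at this ⊢
      rw [← this, AlgHom.comp_apply]
      have h' : elemHom z (1 : MvPolynomial (Fin n) K) P = P := h
      rw [h', ih]
  have hΨ : Ψ P = Polynomial.C P := by
    refine Polynomial.eq_of_infinite_eval_eq _ _ ?_
    refine (Set.infinite_range_of_injective (f := fun m : ℕ => (m : MvPolynomial (Fin n) K))
      Nat.cast_injective).mono ?_
    rintro _ ⟨m, rfl⟩
    simp [hev, hm]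
  have h0 : elemHom z (-X z) P = P := by rw [← hev, hΨ, Polynomial.eval_C]
  rw [← h0]
  refine map_supported_mem (s := Set.univ) _ _ (fun i _ => ?_) (by simp)
  rcases eq_or_ne i z with rfl | hi
  · simp [elemHom_X_self]
  · rw [elemHom_X_of_ne hi]
    exact X_mem_without hi

variable {z : Fin n} {β : Aut n K}

theorem map_mem_without (hβ : Commute β (elem z 1)) {P : MvPolynomial (Fin n) K}
    (hP : P ∈ without K z) : β P ∈ without K z := by
  apply mem_without_of_elem_one_eq
  rw [← AlgEquiv.mul_apply, ← hβ.eq, AlgEquiv.mul_apply, elem_of_mem 1 hP]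

theorem map_X_sub_mem_without (hβ : Commute β (elem z 1)) : β (X z) - X z ∈ without K z := by
  apply mem_without_of_elem_one_eq
  rw [map_sub, ← AlgEquiv.mul_apply, ← hβ.eq, AlgEquiv.mul_apply, elem_X_self, map_add]
  simp

/-- `β` preserves the polynomials free of `x_z` and moves `x_z` by such a polynomial, which the
elementary automorphisms fix. This is the source of new elementary elements of `H`. -/
theorem conj_elem (hβ : Commute β (elem z 1)) (h : without K z) :
    β * elem z h * β⁻¹ = elem z ⟨β h, map_mem_without hβ h.2⟩ := by
  rw [mul_inv_eq_iff_eq_mul]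
  refine algEquiv_ext fun i => ?_
  rw [AlgEquiv.mul_apply, AlgEquiv.mul_apply]
  rcases eq_or_ne i z with rfl | hi
  · obtain ⟨b, hb⟩ : ∃ b ∈ without K i, β (X i) = X i + b :=
      ⟨_, map_X_sub_mem_without hβ, by ring⟩
    rw [elem_X_self, map_add, hb.2, map_add, elem_X_self, elem_of_mem _ hb.1]
    ring
  · rw [elem_X_of_ne hi, elem_of_mem _ (map_mem_without hβ (X_mem_without hi))]

end Commute

end

section

/-- The usual elimination: `B - μ a` kills one summand and rescales the others by nonzero factors.
-/
theorem mem_of_sum_mem_of_eigenvectors {K M ι : Type*} [Field K] [AddCommGroup M] [Module K M]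
    (V : Submodule K M) (B : M →ₗ[K] M) (hB : ∀ x ∈ V, B x ∈ V) (μ : ι → K) (s : Finset ι)
    (hμ : Set.InjOn μ s) (P : ι → M) (hP : ∀ k ∈ s, B (P k) = μ k • P k)
    (hsum : ∑ k ∈ s, P k ∈ V) : ∀ k ∈ s, P k ∈ V := by
  classical
  induction s using Finset.induction_on generalizing P with
  | empty => simp
  | insert a s ha ih =>
    have key : ∀ k ∈ s, P k ∈ V := by
      intro k hk
      have h1 : ∑ k ∈ s, (μ k - μ a) • P k ∈ V := by
        have e : ∑ k ∈ s, (μ k - μ a) • P k =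
            B (∑ k ∈ insert a s, P k) - μ a • ∑ k ∈ insert a s, P k := by
          rw [map_sum, Finset.sum_congr rfl hP, Finset.smul_sum, ← Finset.sum_sub_distrib,
            Finset.sum_insert ha, sub_self, zero_add]
          simp [sub_smul]
        rw [e]
        exact V.sub_mem (hB _ hsum) (V.smul_mem _ hsum)
      have h2 := ih (hμ.mono (by simp)) (fun k => (μ k - μ a) • P k)
        (fun k hk => by rw [map_smul, hP k (Finset.mem_insert_of_mem hk), smul_comm]) h1 k hk
      have hne : μ k - μ a ≠ 0 := sub_ne_zero.mpr fun h =>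
        ha (hμ (Finset.mem_insert_of_mem hk) (Finset.mem_insert_self a s) h ▸ hk)
      simpa [smul_smul, inv_mul_cancel₀ hne] using V.smul_mem (μ k - μ a)⁻¹ h2
    intro k hk
    rcases Finset.mem_insert.mp hk with rfl | hk
    · rw [Finset.sum_insert ha] at hsum
      simpa using V.sub_mem hsum (V.sum_mem key)
    · exact key k hk

variable {n : ℕ} {K : Type*} [Field K]

/-! ### Diagonal automorphisms -/

/-- The diagonal automorphism that multiplies `x_i` by `u_i`. -/
noncomputable def diag (u : Fin n → Kˣ) :
    Aut n K :=
  AlgEquiv.ofAlgHom (aeval fun i => C (u i : K) * X i) (aeval fun i => C ((u i)⁻¹ : K) * X i)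
    (MvPolynomial.algHom_ext fun i => by simp [algebraMap_eq, ← mul_assoc, ← C_mul])
    (MvPolynomial.algHom_ext fun i => by simp [algebraMap_eq, ← mul_assoc, ← C_mul])

@[simp] theorem diag_X (u : Fin n → Kˣ) (i : Fin n) : diag u (X i) = C (u i : K) * X i := by
  simp [diag]

theorem isAff_diag (u : Fin n → Kˣ) : IsAff (diag u) := fun i => by
  rw [diag_X]
  exact C_mul_X_mem_affineFns _ _

theorem diag_monomial (u : Fin n → Kˣ) (m : Fin n →₀ ℕ) (c : K) :
    diag u (monomial m c) = (∏ i, (u i : K) ^ m i) • monomial m c := by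
  rw [monomial_eq, map_mul, algEquiv_C, smul_eq_C_mul, mul_left_comm]
  congr 1
  rw [Finsupp.prod_fintype _ _ (by simp), map_prod, map_prod, ← Finset.prod_mul_distrib]
  exact Finset.prod_congr rfl fun i _ => by simp [mul_pow]

theorem diag_of_mem {u : Fin n → Kˣ} {s : Set (Fin n)} (hu : ∀ i ∈ s, u i = 1)
    {P : MvPolynomial (Fin n) K} (hP : P ∈ supported K s) : diag u P = P :=
  eqOn_supported (diag u : _ →ₐ[K] _) (AlgHom.id K _) (fun i hi => by simp [hu i hi]) hP

/-! ### Conjugates of elementary automorphisms -/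

theorem conj_elem_of_map {γ : Aut n K}
    {z z' : Fin n} {c : K} (hc : c ≠ 0) (hz : γ (X z) = C c * X z')
    (hγ : ∀ i ≠ z, γ (X i) ∈ without K z') (h : without K z) :
    ∃ hh : C c⁻¹ * γ h ∈ without K z', γ * elem z h * γ⁻¹ = elem z' ⟨C c⁻¹ * γ h, hh⟩ := by
  have hm : γ h ∈ without K z' :=
    map_supported_mem (γ : MvPolynomial (Fin n) K →ₐ[K] MvPolynomial (Fin n) K) _ hγ h.2
  refine ⟨mul_mem (Subalgebra.algebraMap_mem _ _) hm, ?_⟩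
  rw [mul_inv_eq_iff_eq_mul]
  refine algEquiv_ext fun i => ?_
  rw [AlgEquiv.mul_apply, AlgEquiv.mul_apply]
  rcases eq_or_ne i z with rfl | hi
  · rw [elem_X_self, map_add, hz, map_mul, elem_X_self, algEquiv_C, mul_add, ← mul_assoc (C c),
      ← C_mul, mul_inv_cancel₀ hc, C_1, one_mul]
  · rw [elem_X_of_ne hi, elem_of_mem _ (hγ i hi)]

/-! ### Elementary automorphisms in a group containing the affine ones -/

section

variable {H : Subgroup (Aut n K)}

/-- The space of polynomials `h` such that the elementary automorphism `x_z ↦ x_z + h` belongs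
to a group `H` that contains all affine automorphisms. -/
noncomputable def elemSpace (hA : ∀ α, IsAff α → α ∈ H) (z : Fin n) :
    Submodule K (MvPolynomial (Fin n) K) where
  carrier := {h | ∃ hh : h ∈ without K z, elem z ⟨h, hh⟩ ∈ H}
  zero_mem' := ⟨zero_mem _, by
    have : elem z ⟨0, zero_mem _⟩ = (1 : Aut n K) := elem_zero z
    rw [this]
    exact one_mem H⟩
  add_mem' := by
    rintro g h ⟨hg, hg'⟩ ⟨hh, hh'⟩
    refine ⟨add_mem hg hh, ?_⟩
    have := elem_add z ⟨g, hg⟩ ⟨h, hh⟩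
    exact this ▸ mul_mem hg' hh'
  smul_mem' := by
    rintro c h ⟨hh, hh'⟩
    rcases eq_or_ne c 0 with rfl | hc
    · refine ⟨by simp, ?_⟩
      have : (⟨(0 : K) • h, by simp⟩ : without K z) = 0 := Subtype.ext (zero_smul K h)
      rw [this, elem_zero]
      exact one_mem H
    -- Conjugation by the scaling of `x_z` by `c⁻¹` multiplies `h` by `c`.
    · let d := diag (Function.update (1 : Fin n → Kˣ) z (Units.mk0 c hc)⁻¹)
      have hd : d h = h := diag_of_mem (fun i hi => by
        rw [Function.update_of_ne (by simpa using hi)]; rfl) hh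
      obtain ⟨h1, h2⟩ := conj_elem_of_map (γ := d) (z := z) (z' := z) (inv_ne_zero hc)
        (by simp [d]) (fun i hi => by simp [d, hi]) ⟨h, hh⟩
      have e : C c⁻¹⁻¹ * d h = c • h := by rw [inv_inv, hd, smul_eq_C_mul]
      simp only [e] at h1 h2
      refine ⟨h1, h2 ▸ ?_⟩
      exact mul_mem (mul_mem (hA _ (isAff_diag _)) hh') (inv_mem (hA _ (isAff_diag _)))

variable (hA : ∀ α, IsAff α → α ∈ H)

theorem mem_elemSpace_coe {z : Fin n} (h : without K z) :
    (h : MvPolynomial (Fin n) K) ∈ elemSpace hA z ↔ elem z h ∈ H :=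
  ⟨fun ⟨_, h⟩ => h, fun hh => ⟨h.2, hh⟩⟩

theorem mem_without_of_mem_elemSpace {z : Fin n} {h : MvPolynomial (Fin n) K}
    (hh : h ∈ elemSpace hA z) : h ∈ without K z := hh.1

theorem mem_elemSpace_of_mem_affineFns {z : Fin n} {h : MvPolynomial (Fin n) K}
    (hh : h ∈ without K z) (ha : h ∈ affineFns n K) : h ∈ elemSpace hA z :=
  ⟨hh, hA _ ((isAff_elem_iff _ _).mpr ha)⟩

theorem map_mem_elemSpace {γ : Aut n K}
    (hγH : γ ∈ H) {z z' : Fin n} (hz : γ (X z) = X z')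
    (hγ : ∀ i ≠ z, γ (X i) ∈ without K z') {h : MvPolynomial (Fin n) K}
    (hh : h ∈ elemSpace hA z) : γ h ∈ elemSpace hA z' := by
  obtain ⟨h1, h2⟩ := hh
  obtain ⟨h3, h4⟩ := conj_elem_of_map (γ := γ) one_ne_zero (by simpa using hz) hγ ⟨h, h1⟩
  simp only [inv_one, C_1, one_mul] at h3 h4
  exact ⟨h3, h4 ▸ mul_mem (mul_mem hγH h2) (inv_mem hγH)⟩

theorem diag_mem_elemSpace {u : Fin n → Kˣ} {z : Fin n} {h : MvPolynomial (Fin n) K}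
    (hu : u z = 1) (hh : h ∈ elemSpace hA z) : diag u h ∈ elemSpace hA z :=
  map_mem_elemSpace hA (hA _ (isAff_diag u)) (by simp [hu]) (fun i hi => by
    rw [diag_X]
    exact mul_mem (Subalgebra.algebraMap_mem _ _) (X_mem_without hi)) hh

theorem elem_apply_mem_elemSpace {j z : Fin n} (hj : j ≠ z) {g : without K j} (hg : elem j g ∈ H)
    (hgz : (g : MvPolynomial (Fin n) K) ∈ without K z) {h : MvPolynomial (Fin n) K}
    (hh : h ∈ elemSpace hA z) : elem j g h ∈ elemSpace hA z :=
  map_mem_elemSpace hA hg (elem_X_of_ne hj.symm g) (fun i hi => by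
    rcases eq_or_ne i j with rfl | hij
    · rw [elem_X_self]
      exact add_mem (X_mem_without hi) hgz
    · rw [elem_X_of_ne hij]
      exact X_mem_without hi) hh

theorem rename_mem_elemSpace (s : Equiv.Perm (Fin n)) {z : Fin n}
    {h : MvPolynomial (Fin n) K} (hh : h ∈ elemSpace hA z) :
    rename s h ∈ elemSpace hA (s z) :=
  map_mem_elemSpace hA (γ := renameEquiv K s)
    (hA _ fun i => by simpa using X_mem_affineFns (K := K) (s i)) (by simp)
    (fun i hi => by simpa using X_mem_without (K := K) (s.injective.ne hi)) hh

variable [CharZero K]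

/-- Unique factorisation: scaling the variables by distinct primes gives distinct monomials distinct
eigenvalues. -/
theorem prod_prime_pow_injective :
    Function.Injective fun m : Fin n →₀ ℕ => ∏ i : Fin n, (Nat.nth Nat.Prime i) ^ m i := by
  have hinj : Function.Injective fun i : Fin n => Nat.nth Nat.Prime i := fun i j h =>
    Fin.ext (Nat.nth_injective Nat.infinite_setOfPred_prime h)
  let e : Fin n ↪ ℕ := ⟨_, hinj⟩
  have key : ∀ m : Fin n →₀ ℕ,
      (∏ i : Fin n, (Nat.nth Nat.Prime i) ^ m i).factorization = m.embDomain e := by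
    intro m
    rw [← Nat.prod_pow_factorization_eq_self (f := m.embDomain e)]
    · rw [Finsupp.prod_embDomain, Finsupp.prod_fintype _ _ (by simp)]
      rfl
    · intro p hp
      rw [Finsupp.support_embDomain, Finset.mem_map] at hp
      obtain ⟨i, -, rfl⟩ := hp
      exact Nat.prime_nth_prime _
  intro m m' h
  have h' := congrArg Nat.factorization h
  simp only [key] at h'
  exact Finsupp.embDomain_injective e h'

theorem monomial_mem_elemSpace {z : Fin n} {h : MvPolynomial (Fin n) K}
    (hh : h ∈ elemSpace hA z) {m : Fin n →₀ ℕ} (hm : m ∈ h.support) :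
    monomial m 1 ∈ elemSpace hA z := by
  have hp : ∀ i : Fin n, ((Nat.nth Nat.Prime i : ℕ) : K) ≠ 0 := fun i =>
    Nat.cast_ne_zero.mpr (Nat.prime_nth_prime _).ne_zero
  -- The entry `1` at `z` makes `diag u` preserve `elemSpace hA z`. Nothing is lost, because `x_z`
  -- does not occur in `h`.
  let u : Fin n → Kˣ := Function.update (fun i => Units.mk0 _ (hp i)) z 1
  have hz : ∀ m ∈ h.support, m z = 0 := by
    intro m hm
    by_contra h0
    have := (mem_supported.mp (mem_without_of_mem_elemSpace hA hh))
      ((mem_vars_iff_mem_support z).mpr ⟨m, hm, Finsupp.mem_support_iff.mpr h0⟩)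
    exact this rfl
  have hμ : ∀ m ∈ h.support, ∏ i, (u i : K) ^ m i =
      ((∏ i : Fin n, (Nat.nth Nat.Prime i) ^ m i : ℕ) : K) := by
    intro m hm
    push_cast
    refine Finset.prod_congr rfl fun i _ => ?_
    rcases eq_or_ne i z with rfl | hi
    · simp [hz m hm]
    · simp [u, hi]
  have := mem_of_sum_mem_of_eigenvectors (elemSpace hA z) (diag u).toLinearMap
    (fun x hx => diag_mem_elemSpace hA (by simp [u]) hx)
    (fun m : Fin n →₀ ℕ => ∏ i, (u i : K) ^ m i) h.support
    (by
      intro m hm m' hm' e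
      simp only [hμ m hm, hμ m' hm'] at e
      exact prod_prime_pow_injective (Nat.cast_injective e))
    (fun m => monomial m (coeff m h)) (fun m _ => diag_monomial u m _)
    (by rwa [← MvPolynomial.as_sum]) m hm
  have h2 := Submodule.smul_mem _ (coeff m h)⁻¹ this
  rwa [smul_monomial, smul_eq_mul, inv_mul_cancel₀ (mem_support_iff.mp hm)] at h2

/-- Substituting `x_j + g` for `x_j` in `x_j ^ N r` and separating the powers of `x_j`. -/
theorem pow_mul_pow_mul_mem_elemSpace {j z : Fin n} (hj : j ≠ z) {g r : MvPolynomial (Fin n) K}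
    (hg : g ∈ affineFns n K) (hgj : g ∈ without K j) (hgz : g ∈ without K z)
    (hr : r ∈ without K j) (b c : ℕ) (h : X j ^ (b + c) * r ∈ elemSpace hA z) :
    X j ^ b * g ^ c * r ∈ elemSpace hA z := by
  have h1 := elem_apply_mem_elemSpace hA hj (g := ⟨g, hgj⟩)
    (hA _ ((isAff_elem_iff _ _).mpr hg)) hgz h
  rw [map_mul, map_pow, elem_X_self, elem_of_mem _ hr, add_pow, Finset.sum_mul] at h1
  -- Doubling `x_j` gives the term of degree `k` in `x_j` the eigenvalue `2 ^ k`.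
  let u : Fin n → Kˣ := Function.update 1 j (Units.mk0 2 two_ne_zero)
  have hu : ∀ P ∈ without K j, diag u P = P := fun P hP =>
    diag_of_mem (fun i hi => by
      simp only [u]
      rw [Function.update_of_ne (by simpa using hi)]
      rfl) hP
  have h2 := mem_of_sum_mem_of_eigenvectors (elemSpace hA z) (diag u).toLinearMap
    (fun x hx => diag_mem_elemSpace hA (by simp [u, hj.symm]) hx)
    (fun k : ℕ => (2 : K) ^ k) _
    (by
      intro k _ k' _ e
      have e' : ((2 ^ k : ℕ) : K) = (2 ^ k' : ℕ) := by push_cast; exact e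
      exact Nat.pow_right_injective le_rfl (Nat.cast_injective e'))
    _
    (fun k _ => by
      simp only [AlgEquiv.toLinearMap_apply, map_mul, map_pow, hu r hr, hu g hgj, diag_X,
        map_natCast]
      simp only [u, Function.update_self, Units.val_mk0, smul_eq_C_mul, map_pow]
      ring) h1 b (by simp)
  have hch : ((b + c).choose b : K) ≠ 0 := Nat.cast_ne_zero.mpr (Nat.choose_pos (by omega)).ne'
  have h3 := Submodule.smul_mem _ ((b + c).choose b : K)⁻¹ h2
  have e : ((b + c).choose b : K)⁻¹ • (X j ^ b * g ^ (b + c - b) * ((b + c).choose b :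
      MvPolynomial (Fin n) K) * r) = X j ^ b * g ^ c * r := by
    rw [smul_eq_C_mul, Nat.add_sub_cancel_left]
    have : C ((b + c).choose b : K)⁻¹ * ((b + c).choose b : MvPolynomial (Fin n) K) = 1 := by
      rw [← map_natCast (C : K →+* MvPolynomial (Fin n) K), ← C_mul, inv_mul_cancel₀ hch, C_1]
    linear_combination X j ^ b * g ^ c * r * this
  rwa [← e]

end

end

/-! ### From one nonaffine elementary automorphism to all triangular ones -/

section

variable {n : ℕ} {K : Type*} [Field K]

/-- An automorphism is triangular if it sends each `x_i` to `u_i x_i + P_i` with `u_i ≠ 0` and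
`P_i` a polynomial in the previous variables. -/
def IsTri (τ : Aut n K) : Prop :=
  ∀ i, ∃ u : Kˣ, ∃ P ∈ supported K (Set.Iio i), τ (X i) = C (u : K) * X i + P

theorem monomial_mem_without {m : Fin n →₀ ℕ} {z : Fin n} (h : m z = 0) (c : K) :
    monomial m c ∈ without K z := by
  refine mem_supported.mpr fun i hi => ?_
  obtain ⟨d, hd, hi⟩ := (mem_vars_iff_mem_support i).mp hi
  rw [Finset.mem_singleton.mp (support_monomial_subset hd)] at hi
  rintro rfl
  exact Finsupp.mem_support_iff.mp hi h

theorem apply_eq_zero_of_mem_without {P : MvPolynomial (Fin n) K} {z : Fin n}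
    (hP : P ∈ without K z) {m : Fin n →₀ ℕ} (hm : m ∈ P.support) : m z = 0 := by
  by_contra h0
  exact (mem_supported.mp hP)
    ((mem_vars_iff_mem_support z).mpr ⟨m, hm, Finsupp.mem_support_iff.mpr h0⟩) rfl

theorem monomial_single_add (j : Fin n) (k : ℕ) (m : Fin n →₀ ℕ) :
    (monomial (Finsupp.single j k + m) 1 : MvPolynomial (Fin n) K) = X j ^ k * monomial m 1 := by
  rw [X_pow_eq_monomial, monomial_mul, one_mul]

theorem monomial_eq_X_pow_mul (m : Fin n →₀ ℕ) (j : Fin n) :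
    (monomial m 1 : MvPolynomial (Fin n) K) = X j ^ m j * monomial (m.erase j) 1 := by
  rw [← monomial_single_add, Finsupp.single_add_erase]

section

variable {H : Subgroup (Aut n K)}
  (hA : ∀ α, IsAff α → α ∈ H)

theorem X_mul_X_mem_elemSpace_of_ne {z i j : Fin n} (hij : i ≠ j) (hi : i ≠ z) (hj : j ≠ z)
    (h : X i * X j ∈ elemSpace hA z) {z' i' j' : Fin n} (hij' : i' ≠ j') (hi' : i' ≠ z')
    (hj' : j' ≠ z') : X i' * X j' ∈ elemSpace hA z' := by
  have inj : ∀ a b c : Fin n, a ≠ b → a ≠ c → b ≠ c → Function.Injective ![a, b, c] := by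
    intro a b c hab hac hbc x y hxy
    fin_cases x <;> fin_cases y <;> simp_all
  obtain ⟨s, hs⟩ := Equiv.Perm.exists_extending_pair ![i, j, z] ![i', j', z']
    (inj _ _ _ hij hi hj) (inj _ _ _ hij' hi' hj')
  have h0 : s i = i' := hs 0
  have h1 : s j = j' := hs 1
  have h2 : s z = z' := hs 2
  have := rename_mem_elemSpace hA s h
  rwa [map_mul, rename_X, rename_X, h0, h1, h2] at this

/-- With a third variable `x_j`, the substitution `x_j ↦ x_j + x_i^(d+1)`, in `H` by induction,
turns `x_i x_j` into `x_i x_j + x_i^(d+2)`. -/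
theorem X_pow_mem_elemSpace (hn : 3 ≤ n)
    (h : ∀ z i j : Fin n, i ≠ j → i ≠ z → j ≠ z → X i * X j ∈ elemSpace hA z) (d : ℕ) :
    ∀ z i : Fin n, i ≠ z → X i ^ (d + 1) ∈ elemSpace hA z := by
  induction d with
  | zero =>
    intro z i hi
    rw [zero_add, pow_one]
    exact mem_elemSpace_of_mem_affineFns hA (X_mem_without hi) (X_mem_affineFns i)
  | succ d ih =>
    intro z i hi
    obtain ⟨j, hj⟩ : ∃ j, j ∉ ({i, z} : Finset (Fin n)) := by
      by_contra! h
      have h1 := Finset.card_le_card (fun j _ => h j : Finset.univ ⊆ ({i, z} : Finset (Fin n)))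
      have h2 := Finset.card_le_two (a := i) (b := z)
      simp at h1
      omega
    simp only [Finset.mem_insert, Finset.mem_singleton, not_or] at hj
    obtain ⟨h1, h2⟩ := ih j i (Ne.symm hj.1)
    have h3 := elem_apply_mem_elemSpace hA hj.2 h2 (pow_mem (X_mem_without hi) _)
      (h z i j (Ne.symm hj.1) hi hj.2)
    rw [map_mul, elem_X_self, elem_X_of_ne (Ne.symm hj.1)] at h3
    have h4 := Submodule.sub_mem _ h3 (h z i j (Ne.symm hj.1) hi hj.2)
    simpa [mul_add, pow_succ'] using h4

/-- The affine and the elementary automorphisms generate all triangular ones. -/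
theorem mem_of_isTri (hA : ∀ α, IsAff α → α ∈ H)
    (hE : ∀ (z : Fin n) (h : without K z), elem z h ∈ H) (k : ℕ) :
    ∀ τ : Aut n K, IsTri τ →
      (∀ i : Fin n, k ≤ i → τ (X i) = X i) → τ ∈ H := by
  induction k with
  | zero =>
    intro τ _ h
    have : τ = 1 := algEquiv_ext fun i => h i (Nat.zero_le _)
    rw [this]
    exact one_mem H
  | succ k ih =>
    intro τ hτ h
    rcases Nat.lt_or_ge k n with hk | hk
    swap
    · exact ih τ hτ fun i hi => absurd i.2 (by omega)
    let z : Fin n := ⟨k, hk⟩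
    obtain ⟨u, P, hP, hu⟩ := hτ z
    have hPz : P ∈ without K z :=
      supported_mono (fun i (hi : i < z) => ne_of_lt hi) hP
    have hPz' : C (u⁻¹ : K) * P ∈ without K z := mul_mem (Subalgebra.algebraMap_mem _ _) hPz
    -- `σ` agrees with `τ` on `x_z` and fixes the other variables, so `σ⁻¹ τ` moves only variables
    -- before `x_z`.
    let σ := elem z ⟨C (u⁻¹ : K) * P, hPz'⟩ * diag (Function.update 1 z u)
    have hσz : σ (X z) = C (u : K) * X z + P := by
      simp only [σ, AlgEquiv.mul_apply, diag_X, Function.update_self, map_mul, algEquiv_C,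
        elem_X_self]
      rw [mul_add, ← mul_assoc (C _) (C _), ← C_mul, mul_inv_cancel₀ u.ne_zero, C_1, one_mul]
    have hσ : ∀ i, i ≠ z → σ (X i) = X i := by
      intro i hi
      simp [σ, AlgEquiv.mul_apply, hi, elem_X_of_ne hi]
    have hσw : ∀ Q ∈ without K z, σ⁻¹ Q = Q := by
      intro Q hQ
      have : σ Q = Q := eqOn_supported (σ : MvPolynomial (Fin n) K →ₐ[K] MvPolynomial (Fin n) K)
        (AlgHom.id K _) hσ hQ
      nth_rewrite 1 [← this]
      rw [← AlgEquiv.mul_apply, inv_mul_cancel, AlgEquiv.one_apply]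
    have hσH : σ ∈ H := mul_mem (hE _ _) (hA _ (isAff_diag _))
    have hz : (σ⁻¹ * τ) (X z) = X z := by
      rw [AlgEquiv.mul_apply, hu, ← hσz, ← AlgEquiv.mul_apply, inv_mul_cancel,
        AlgEquiv.one_apply]
    have hgt : ∀ i : Fin n, z < i → (σ⁻¹ * τ) (X i) = X i := by
      intro i hi
      rw [AlgEquiv.mul_apply, h i hi, hσw _ (X_mem_without hi.ne')]
    have hlt : ∀ i : Fin n, i < z → (σ⁻¹ * τ) (X i) = τ (X i) := by
      intro i hi
      obtain ⟨v, Q, hQ, hv⟩ := hτ i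
      rw [AlgEquiv.mul_apply, hv, hσw]
      exact add_mem (mul_mem (Subalgebra.algebraMap_mem _ _) (X_mem_without hi.ne))
        (supported_mono (fun j (hj : j < i) => ne_of_lt (hj.trans hi)) hQ)
    have h2 := ih (σ⁻¹ * τ) (fun i => by
        rcases lt_trichotomy i z with hi | rfl | hi
        · rw [hlt i hi]
          exact hτ i
        · exact ⟨1, 0, zero_mem _, by simp [hz]⟩
        · exact ⟨1, 0, zero_mem _, by simp [hgt i hi]⟩) (fun i hi => by
        rcases eq_or_lt_of_le (show z ≤ i from hi) with rfl | hi
        · exact hz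
        · exact hgt i hi)
    simpa using mul_mem hσH h2

variable [CharZero K]

/-- Substituting `x_j + 1` for a variable that occurs and extracting the next lower power of `x_j`
lowers the degree by one. -/
theorem exists_degree_eq_two_of_mem_elemSpace {z : Fin n} (d : ℕ) (m : Fin n →₀ ℕ)
    (hd : m.degree = d + 2) (hm : monomial m 1 ∈ elemSpace hA z) :
    ∃ m : Fin n →₀ ℕ, m.degree = 2 ∧ monomial m 1 ∈ elemSpace hA z := by
  induction d generalizing m with
  | zero => exact ⟨m, hd, hm⟩
  | succ d ih =>
    obtain ⟨j, hj⟩ : ∃ j, m j ≠ 0 := by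
      by_contra! h
      have : m = 0 := Finsupp.ext h
      simp [this] at hd
    obtain ⟨b, hb⟩ := Nat.exists_eq_succ_of_ne_zero hj
    have hz := apply_eq_zero_of_mem_without (mem_without_of_mem_elemSpace hA hm) (m := m)
      (by simp [mem_support_iff])
    have hjz : j ≠ z := fun h => hj (h ▸ hz)
    have h1 := pow_mul_pow_mul_mem_elemSpace hA hjz one_mem_affineFns (one_mem _) (one_mem _)
      (monomial_mem_without (m := m.erase j) (c := 1) (by simp)) b 1
      (by rwa [monomial_eq_X_pow_mul m j, hb] at hm)
    rw [one_pow, mul_one, ← monomial_single_add] at h1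
    refine ih _ ?_ h1
    have h2 := congrArg Finsupp.degree (Finsupp.single_add_erase j m)
    simp only [map_add, Finsupp.degree_single] at h2 ⊢
    omega

/-- A group that contains the affine automorphisms and a nonaffine elementary automorphism
contains a quadratic one. -/
theorem X_mul_X_mem_elemSpace (hn : 3 ≤ n) {z : Fin n} {h : MvPolynomial (Fin n) K}
    (hh : h ∈ elemSpace hA z) (hdeg : h ∉ affineFns n K) :
    ∃ i j, i ≠ j ∧ i ≠ z ∧ j ≠ z ∧ X i * X j ∈ elemSpace hA z := by
  have hdeg' : 1 < h.totalDegree := by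
    rw [mem_restrictTotalDegree] at hdeg
    omega
  obtain ⟨m, hm, hmd⟩ : ∃ m ∈ h.support, 1 < m.degree := by
    rw [totalDegree, Finset.lt_sup_iff] at hdeg'
    exact hdeg'
  obtain ⟨m, hm2, hm⟩ := exists_degree_eq_two_of_mem_elemSpace hA (m.degree - 2) m (by omega)
    (monomial_mem_elemSpace hA hh hm)
  have hz := apply_eq_zero_of_mem_without (mem_without_of_mem_elemSpace hA hm) (m := m)
    (by simp [mem_support_iff])
  obtain ⟨i, hi⟩ : ∃ i, m i ≠ 0 := by
    by_contra! h
    have : m = 0 := Finsupp.ext h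
    simp [this] at hm2
  have hiz : i ≠ z := fun h => hi (h ▸ hz)
  have hdi := congrArg Finsupp.degree (Finsupp.single_add_erase i m)
  simp only [map_add, Finsupp.degree_single] at hdi
  rcases (by omega : m i = 1 ∨ m i = 2) with h1 | h2
  · obtain ⟨j, hj⟩ := (Finsupp.sum_eq_one_iff (m.erase i)).mp
      (show (m.erase i).degree = 1 by omega)
    have hji : j ≠ i := by
      rintro rfl
      have := DFunLike.congr_fun hj j
      simp at this
    have hjz : j ≠ z := by
      rintro rfl
      have := DFunLike.congr_fun hj j
      simp [Finsupp.erase_ne hji, hz] at this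
    refine ⟨i, j, hji.symm, hiz, hjz, ?_⟩
    rw [monomial_eq_X_pow_mul m i, h1, hj, pow_one] at hm
    exact hm
  · obtain ⟨j, hj⟩ : ∃ j, j ∉ ({i, z} : Finset (Fin n)) := by
      by_contra! h
      have h1 := Finset.card_le_card (fun j _ => h j : Finset.univ ⊆ ({i, z} : Finset (Fin n)))
      have h2 := Finset.card_le_two (a := i) (b := z)
      simp at h1
      omega
    simp only [Finset.mem_insert, Finset.mem_singleton, not_or] at hj
    refine ⟨i, j, Ne.symm hj.1, hiz, hj.2, ?_⟩
    have h0 : m.erase i = 0 := by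
      rw [← Finsupp.degree_eq_zero_iff]
      omega
    -- Polarisation of a square: substitute `x_i + x_j` in `x_i ^ 2` and keep the mixed term.
    have h3 := pow_mul_pow_mul_mem_elemSpace hA hiz (X_mem_affineFns j)
      (X_mem_without hj.1) (X_mem_without hj.2) (one_mem _) 1 1
      (by rw [monomial_eq_X_pow_mul m i, h2, h0] at hm; simpa using hm)
    simpa using h3

/-- Polarisation again: moving the whole exponent of `x_j` to `x_i` leaves fewer variables, and the
substitution of `x_i + x_j` for `x_i` recovers the original monomial. -/
theorem monomial_mem_elemSpace_of_X_pow
    (h : ∀ (d : ℕ) (z i : Fin n), i ≠ z → X i ^ (d + 1) ∈ elemSpace hA z) {z : Fin n} (k : ℕ) :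
    ∀ m : Fin n →₀ ℕ, m z = 0 → m.support.card ≤ k → monomial m 1 ∈ elemSpace hA z := by
  induction k with
  | zero =>
    intro m _ hk
    have : m = 0 := by simpa using hk
    rw [this]
    exact mem_elemSpace_of_mem_affineFns hA (one_mem _) one_mem_affineFns
  | succ k ih =>
    intro m hz hk
    rcases Nat.lt_or_ge m.support.card 2 with h2 | h2
    · rcases Nat.eq_zero_or_pos m.support.card with h0 | h0
      · exact ih m hz (by omega)
      · obtain ⟨i, b, hb, rfl⟩ := Finsupp.card_support_eq_one'.mp
          (show m.support.card = 1 by omega)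
        obtain ⟨b, rfl⟩ := Nat.exists_eq_succ_of_ne_zero hb
        have hi : i ≠ z := by
          rintro rfl
          simp at hz
        simpa [X_pow_eq_monomial] using h b z i hi
    · obtain ⟨i, hi, j, hj, hij⟩ := Finset.one_lt_card.mp h2
      rw [Finsupp.mem_support_iff] at hi hj
      have hiz : i ≠ z := fun h => hi (h ▸ hz)
      have hjz : j ≠ z := fun h => hj (h ▸ hz)
      have h3 := ih (Finsupp.single i (m i + m j) + (m.erase j).erase i)
        (by simp [hz, Finsupp.erase_ne, hiz.symm, hjz.symm]) (by
          have hs : (Finsupp.single i (m i + m j) + (m.erase j).erase i).support ⊆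
              m.support.erase j := by
            intro a ha
            rw [Finsupp.mem_support_iff] at ha
            rw [Finset.mem_erase, Finsupp.mem_support_iff]
            rcases eq_or_ne a i with rfl | hai
            · exact ⟨hij, hi⟩
            · rcases eq_or_ne a j with rfl | haj
              · simp [Finsupp.erase_ne, hij.symm] at ha
              · exact ⟨haj, by simpa [Finsupp.erase_ne, hai, haj, hai.symm] using ha⟩
          have := Finset.card_le_card hs
          rw [Finset.card_erase_of_mem (Finsupp.mem_support_iff.mpr hj)] at this
          omega)
      rw [monomial_single_add] at h3
      have h4 := pow_mul_pow_mul_mem_elemSpace hA hiz (X_mem_affineFns j) (X_mem_without hij.symm)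
        (X_mem_without hjz) (monomial_mem_without (by simp) _) _ _ h3
      rw [monomial_eq_X_pow_mul m j, monomial_eq_X_pow_mul (m.erase j) i]
      rw [Finsupp.erase_ne hij, ← mul_assoc, mul_comm (X j ^ m j)]
      exact h4

theorem without_le_elemSpace (hn : 3 ≤ n) {z : Fin n} {h : MvPolynomial (Fin n) K}
    (hh : h ∈ elemSpace hA z) (hdeg : h ∉ affineFns n K) {z' : Fin n}
    {P : MvPolynomial (Fin n) K} (hP : P ∈ without K z') : P ∈ elemSpace hA z' := by
  obtain ⟨i, j, hij, hi, hj, hX⟩ := X_mul_X_mem_elemSpace hA hn hh hdeg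
  have h1 := X_pow_mem_elemSpace hA hn fun z' i' j' hij' hi' hj' =>
    X_mul_X_mem_elemSpace_of_ne hA hij hi hj hX hij' hi' hj'
  rw [P.as_sum]
  refine Submodule.sum_mem _ fun m hm => ?_
  have h2 := monomial_mem_elemSpace_of_X_pow hA h1 _ m (apply_eq_zero_of_mem_without hP hm) le_rfl
  simpa [smul_monomial] using Submodule.smul_mem _ (coeff m P) h2

/-- A group that contains the affine automorphisms and a nonaffine elementary automorphism
contains all triangular automorphisms. -/
theorem isTri_mem_of_elem_mem (hA : ∀ α, IsAff α → α ∈ H) (hn : 3 ≤ n)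
    {z : Fin n} {h : without K z} (hh : elem z h ∈ H)
    (hdeg : (h : MvPolynomial (Fin n) K) ∉ affineFns n K)
    {τ : Aut n K} (hτ : IsTri τ) : τ ∈ H := by
  refine mem_of_isTri hA (fun z' g => ?_) n τ hτ (fun i hi => absurd i.2 (by omega))
  rw [← mem_elemSpace_coe hA]
  exact without_le_elemSpace hA hn ((mem_elemSpace_coe hA h).mpr hh) hdeg g.2

end

end

/-! ### Conjugating a translation to an affine automorphism that is not a translation -/

section

variable {n : ℕ} {K : Type*} [Field K]

/-- For an automorphism that is not a translation the first differences of the variables are not all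
constant, so the last nonconstant order has the form `k + 1`. The `k`-th difference then serves as
the `ℓ` of `not_isAff_conj_elem`. -/
theorem exists_last_diff_of_ne_trans {A : Aut n K}
    (hA : ∀ v, A ≠ trans v) (hnil : ∀ P, ∃ k, (diff A ^ k) P = 0) :
    ∃ k, (∃ i, ∀ c, (diff A ^ (k + 1)) (X i) ≠ C c) ∧
      ∀ i, ∃ c, (diff A ^ (k + 2)) (X i) = C c := by
  classical
  have hex : ∃ k, ∀ i, ∃ c, (diff A ^ k) (X i) = C c := by
    choose k hk using fun i => hnil (X i)
    exact ⟨Finset.univ.sup k, fun i => ⟨0, by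
      rw [diff_pow_mono A (Finset.le_sup (Finset.mem_univ i)) (hk i), C_0]⟩⟩
  have h1 : ¬ ∀ i, ∃ c, (diff A ^ 1) (X i) = C c := by
    intro h
    choose v hv using h
    refine hA v (algEquiv_ext fun i => ?_)
    rw [trans_X, ← hv i, pow_one, diff_apply, add_sub_cancel]
  have h0 : ¬ ∀ i, ∃ c, (diff A ^ 0) (X i) = C c := by
    intro h
    refine h1 fun i => ?_
    obtain ⟨c, hc⟩ := h i
    rw [pow_zero, Module.End.one_apply] at hc
    exact ⟨0, by rw [pow_one, hc, diff_apply, algEquiv_C, sub_self, C_0]⟩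
  have hne : ∀ k, k ≤ 1 → Nat.find hex ≠ k := by
    intro k hk h
    have := Nat.find_spec hex
    rw [h] at this
    rcases Nat.le_one_iff_eq_zero_or_eq_one.mp hk with rfl | rfl
    exacts [h0 this, h1 this]
  have h2 : Nat.find hex = (Nat.find hex - 2) + 2 := by
    have := hne 0 (by omega)
    have := hne 1 le_rfl
    omega
  refine ⟨Nat.find hex - 2, ?_, ?_⟩
  · have := Nat.find_min hex (m := Nat.find hex - 2 + 1) (by omega)
    push Not at this
    exact this
  · rw [← h2]
    exact Nat.find_spec hex

theorem isAff_conj_diff_mem {A : Aut n K}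
    (hA : IsAff A) (k : ℕ) {P : MvPolynomial (Fin n) K} (hP : P ∈ affineFns n K) :
    (diff A ^ k) P ∈ affineFns n K := by
  induction k with
  | zero => simpa using hP
  | succ k ih =>
    rw [pow_succ', Module.End.mul_apply]
    exact Submodule.sub_mem _ (hA.map_mem ih) ih

theorem exists_conj_elem_one_diff_pow_eq_zero (z : Fin n)
    (φ : Aut n K) (P : MvPolynomial (Fin n) K) :
    ∃ k, (diff (φ * elem z 1 * φ⁻¹) ^ k) P = 0 := by
  rw [elem_one_eq_trans]
  exact exists_diff_conj_trans_pow_eq_zero φ _ P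

variable [CharZero K]

section

variable {H : Subgroup (Aut n K)}

/-- Conjugating `x_z ↦ x_z + x_i` by `β` gives the elementary automorphism with `β x_i`, which `hE`
forces to be affine. Up to an affine factor `β` is then elementary along `x_z`, and `hE` applies
once more. -/
theorem isAff_of_commute_elem (hA : ∀ α, IsAff α → α ∈ H)
    (hE : ∀ (z : Fin n) (h : without K z), elem z h ∈ H →
      (h : MvPolynomial (Fin n) K) ∈ affineFns n K)
    {z : Fin n} {β : Aut n K}
    (hβ : β ∈ H) (hc : Commute β (elem z 1)) : IsAff β := by
  have h1 : ∀ i, i ≠ z → β (X i) ∈ affineFns n K := by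
    intro i hi
    have h2 := conj_elem hc ⟨X i, X_mem_without hi⟩
    refine hE z _ (h2 ▸ mul_mem (mul_mem hβ (hA _ ?_)) (inv_mem hβ))
    exact (isAff_elem_iff _ _).mpr (X_mem_affineFns i)
  obtain ⟨b, hb⟩ : ∃ b : without K z, β (X z) = X z + (b : MvPolynomial (Fin n) K) :=
    ⟨⟨_, map_X_sub_mem_without hc⟩, by simp⟩
  have hγ : IsAff (elem z (-b) * β) := by
    intro i
    rw [AlgEquiv.mul_apply]
    rcases eq_or_ne i z with rfl | hi
    · rw [hb, map_add, elem_X_self, elem_of_mem _ b.2]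
      simpa using X_mem_affineFns i
    · rw [elem_of_mem _ (map_mem_without hc (X_mem_without hi))]
      exact h1 i hi
  have h3 : elem z (-b) ∈ H := by
    simpa using mul_mem (hA _ hγ) (inv_mem hβ)
  have h4 := hE z _ h3
  intro i
  rcases eq_or_ne i z with rfl | hi
  · rw [hb]
    exact Submodule.add_mem _ (X_mem_affineFns i) (by simpa using Submodule.neg_mem _ h4)
  · exact h1 i hi

/-- Write `A` for the conjugated translation, `m = Aℓ - ℓ` and `f = φ h`. The conjugate of `elem z
h` sends `ℓ` to `ℓ + f (m + (c/2)(f - 1))`, a flow formula at time `f`. Neither factor of the added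
product is constant, so its degree is at least two. -/
theorem not_isAff_conj_elem {z : Fin n}
    {φ : Aut n K}
    {ℓ : MvPolynomial (Fin n) K} (hℓ : ℓ ∈ affineFns n K)
    (hm : ∀ c, diff (φ * elem z 1 * φ⁻¹) ℓ ≠ C c) {c : K}
    (hA : IsAff (φ * elem z 1 * φ⁻¹))
    (hc : diff (φ * elem z 1 * φ⁻¹) (diff (φ * elem z 1 * φ⁻¹) ℓ) = C c)
    {h : without K z} (hh : ∀ c, (h : MvPolynomial (Fin n) K) ≠ C c) :
    ¬ IsAff (φ * elem z h * φ⁻¹) := by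
  intro hE
  set A := φ * elem z 1 * φ⁻¹ with hAdef
  set E := φ * elem z h * φ⁻¹ with hEdef
  set m := diff A ℓ with hmdef
  have hφ : ∀ P, φ (φ⁻¹ P) = P := fun P => by
    rw [← AlgEquiv.mul_apply, mul_inv_cancel, AlgEquiv.one_apply]
  have hφ' : ∀ P, φ⁻¹ (φ P) = P := fun P => by
    rw [← AlgEquiv.mul_apply, inv_mul_cancel, AlgEquiv.one_apply]
  have hTL : elem z 1 (φ⁻¹ ℓ) = φ⁻¹ ℓ + φ⁻¹ m := by
    rw [← map_add, hmdef, diff_apply, add_sub_cancel, hAdef, AlgEquiv.mul_apply,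
      AlgEquiv.mul_apply, hφ']
  have hTM : elem z 1 (φ⁻¹ m) = φ⁻¹ m + C c := by
    rw [← algEquiv_C φ⁻¹ c, ← map_add, ← hc, diff_apply, add_sub_cancel, hAdef,
      AlgEquiv.mul_apply, AlgEquiv.mul_apply, hφ']
  have hz1 : elem z (1 : without K z) (X z) = X z + 1 := by simp
  set M := φ⁻¹ m with hMdef
  have hM0 : M - C c * X z ∈ without K z := by
    apply mem_without_of_elem_one_eq
    rw [map_sub, hTM, map_mul, algEquiv_C, hz1]
    ring
  have hSM : elem z h M = M + C c * (h : MvPolynomial (Fin n) K) := by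
    have := elem_of_mem h hM0
    rw [map_sub, map_mul, algEquiv_C, elem_X_self] at this
    linear_combination this
  have h2 : (C (2⁻¹ : K) : MvPolynomial (Fin n) K) * 2 = 1 := by
    rw [← map_ofNat (C : K →+* MvPolynomial (Fin n) K) 2, ← C_mul, inv_mul_cancel₀ two_ne_zero,
      C_1]
  -- The subtracted term is a discrete antiderivative of `M` along `x_z`, as the difference of `M`
  -- is the constant `c`.
  have hL0 : φ⁻¹ ℓ - (X z * M - C 2⁻¹ * C c * (X z ^ 2 + X z)) ∈ without K z := by
    apply mem_without_of_elem_one_eq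
    rw [map_sub, hTL, map_sub, map_mul, map_mul, map_mul, map_add, map_pow, hTM, hz1, algEquiv_C,
      algEquiv_C]
    linear_combination C c * (X z + 1) * h2
  have hSL : elem z h (φ⁻¹ ℓ) = φ⁻¹ ℓ + (h : MvPolynomial (Fin n) K) *
      (M + C 2⁻¹ * C c * ((h : MvPolynomial (Fin n) K) - 1)) := by
    have := elem_of_mem h hL0
    rw [map_sub, map_sub, map_mul, map_mul, map_mul, map_add, map_pow, hSM, elem_X_self,
      algEquiv_C, algEquiv_C] at this
    linear_combination this - C c * (h : MvPolynomial (Fin n) K) * (X z + h) * h2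
  set f := φ h with hfdef
  have hf : ∀ c, f ≠ C c := fun c hc => hh c ((map_eq_C_iff φ).mp hc)
  have hEm : E m = m + C c * f := by
    rw [hEdef, AlgEquiv.mul_apply, AlgEquiv.mul_apply, hSM, map_add, map_mul, algEquiv_C, hφ]
  have hEℓ : E ℓ = ℓ + f * (m + C 2⁻¹ * C c * (f - 1)) := by
    rw [hEdef, AlgEquiv.mul_apply, AlgEquiv.mul_apply, hSL]
    simp only [map_add, map_mul, map_sub, map_one, algEquiv_C, hφ, hMdef]
    rfl
  have hmA : m ∈ affineFns n K := Submodule.sub_mem _ (hA.map_mem hℓ) hℓ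
  have h4 : f * (m + C 2⁻¹ * C c * (f - 1)) ∈ affineFns n K := by
    have := Submodule.sub_mem _ (hE.map_mem hℓ) hℓ
    rwa [hEℓ, add_sub_cancel_left] at this
  refine mul_notMem_affineFns hf (fun d hd => ?_) h4
  -- If the second factor were a constant `d`, applying `A`, which fixes `f` and adds `c` to `m`,
  -- would give `c = 0` and then `m = d`.
  have hAf : A f = f := by
    rw [hAdef, AlgEquiv.mul_apply, AlgEquiv.mul_apply, hfdef, hφ', elem_of_mem _ h.2]
  have hAm : A m = m + C c := by
    rw [← hc, diff_apply, add_sub_cancel]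
  have h5 := congrArg A hd
  rw [algEquiv_C, ← hd, map_add, map_mul, map_mul, map_sub, hAf, hAm, algEquiv_C, algEquiv_C,
    map_one] at h5
  have hc0 : c = 0 := by
    have : (C c : MvPolynomial (Fin n) K) = C 0 := by
      rw [C_0]
      linear_combination h5
    exact C_injective _ _ this
  rw [hc0, C_0, mul_zero, zero_mul, add_zero] at hd
  exact hm d hd

/-- The elementary automorphisms along the invariants of a translation that stay affine under a
conjugation `φ` only involve constants, if one of the invariants is killed by the target
translation. -/
theorem false_of_map_invariant (hA : ∀ α, IsAff α → α ∈ H)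
    (hE : ∀ (z : Fin n) (h : without K z), elem z h ∈ H →
      (h : MvPolynomial (Fin n) K) ∈ affineFns n K)
    {z : Fin n} {φ : Aut n K} (hφ : φ ∈ H)
    (haff : IsAff (φ * elem z 1 * φ⁻¹)) (htr : ∀ v, φ * elem z 1 * φ⁻¹ ≠ trans v)
    (hcomm : Commute (φ * elem z 1 * φ⁻¹) (elem z 1)) (h : without K z)
    (hh : (h : MvPolynomial (Fin n) K) ∈ affineFns n K)
    (hne : ∀ c, (h : MvPolynomial (Fin n) K) ≠ C c)
    (hinv : elem z 1 (φ h) = φ h) : False := by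
  obtain ⟨k, ⟨i, hi⟩, hk⟩ := exists_last_diff_of_ne_trans htr
    (exists_conj_elem_one_diff_pow_eq_zero z φ)
  obtain ⟨c, hc⟩ := hk i
  have hβ : Commute (φ⁻¹ * elem z 1 * φ) (elem z 1) := by
    have := hcomm.map (MulAut.conj φ⁻¹)
    simp only [MulAut.conj_apply, inv_inv] at this
    have e : φ⁻¹ * (φ * elem z 1 * φ⁻¹) * φ = elem z 1 := by group
    rw [e] at this
    exact this.symm
  -- Equivalently, `φ⁻¹ (elem z 1) φ` commutes with `elem z h`. It does because it commutes with
  -- `elem z 1` and fixes `h` by `hinv`.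
  have hcE : Commute (φ * elem z h * φ⁻¹) (elem z 1) := by
    have h1 := conj_elem hβ h
    have h2 : (⟨(φ⁻¹ * elem z 1 * φ : Aut n K) h, map_mem_without hβ h.2⟩ : without K z) = h := by
      refine Subtype.ext ?_
      simp only [AlgEquiv.mul_apply]
      rw [hinv, ← AlgEquiv.mul_apply, inv_mul_cancel, AlgEquiv.one_apply]
    rw [h2, mul_inv_eq_iff_eq_mul] at h1
    have h3 := (show Commute (φ⁻¹ * elem z 1 * φ) (elem z h) from h1).map (MulAut.conj φ)
    simp only [MulAut.conj_apply] at h3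
    have e : φ * (φ⁻¹ * elem z 1 * φ) * φ⁻¹ = elem z 1 := by group
    rw [e] at h3
    exact h3.symm
  refine not_isAff_conj_elem (ℓ := (diff (φ * elem z 1 * φ⁻¹) ^ k) (X i))
    (isAff_conj_diff_mem haff k (X_mem_affineFns i)) (fun c => ?_) haff (c := c) ?_ hne
    (isAff_of_commute_elem hA hE
      (mul_mem (mul_mem hφ (hA _ ((isAff_elem_iff _ _).mpr hh))) (inv_mem hφ)) hcE)
  · rw [← Module.End.mul_apply, ← pow_succ']
    exact hi c
  · rw [← Module.End.mul_apply, ← Module.End.mul_apply, mul_assoc, ← pow_succ', ← pow_succ']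
    exact hc

/-- Some nonconstant affine `h` free of `x_z` changes by a constant `c` under `φ⁻¹ (elem z 1) φ`. If
`c = 0`, then `h` contradicts `false_of_map_invariant`. If `c ≠ 0`, the affine automorphism `φ⁻¹
(elem z ℓ) φ` adds `c φ⁻¹ ℓ` to `h`, so `φ⁻¹ ℓ` is affine and takes the place of `h`. -/
theorem false_of_invariant_affine (hn : 3 ≤ n) (hA : ∀ α, IsAff α → α ∈ H)
    (hE : ∀ (z : Fin n) (h : without K z), elem z h ∈ H →
      (h : MvPolynomial (Fin n) K) ∈ affineFns n K)
    {z : Fin n} {φ : Aut n K} (hφ : φ ∈ H)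
    (haff : IsAff (φ * elem z 1 * φ⁻¹)) (htr : ∀ v, φ * elem z 1 * φ⁻¹ ≠ trans v)
    (hcomm : Commute (φ * elem z 1 * φ⁻¹) (elem z 1)) (ℓ : without K z)
    (hℓ : (ℓ : MvPolynomial (Fin n) K) ∈ affineFns n K)
    (hne : ∀ c, (ℓ : MvPolynomial (Fin n) K) ≠ C c)
    (hinv : (φ * elem z 1 * φ⁻¹ : Aut n K) ℓ = ℓ) : False := by
  have hφ1 : ∀ P, φ (φ⁻¹ P) = P := fun P => by
    rw [← AlgEquiv.mul_apply, mul_inv_cancel, AlgEquiv.one_apply]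
  have hφ2 : ∀ P, φ⁻¹ (φ P) = P := fun P => by
    rw [← AlgEquiv.mul_apply, inv_mul_cancel, AlgEquiv.one_apply]
  have e : φ⁻¹ * (φ * elem z 1 * φ⁻¹) * φ = elem z 1 := by group
  have hconj : ∀ g : Aut n K,
      Commute (φ * elem z 1 * φ⁻¹) g → Commute (φ⁻¹ * g * φ) (elem z 1) := by
    intro g hg
    have := hg.map (MulAut.conj φ⁻¹)
    simp only [MulAut.conj_apply, inv_inv] at this
    rw [e] at this
    exact this.symm
  have hT : elem z (1 : without K z) ∈ H :=
    hA _ ((isAff_elem_iff _ _).mpr (by simpa using one_mem_affineFns))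
  have hS : elem z ℓ ∈ H := hA _ ((isAff_elem_iff _ _).mpr hℓ)
  have hβ := hconj _ hcomm
  have hβaff := isAff_of_commute_elem hA hE (mul_mem (mul_mem (inv_mem hφ) hT) hφ) hβ
  have hcommS : Commute (φ * elem z 1 * φ⁻¹) (elem z ℓ) := by
    have h1 := conj_elem hcomm ℓ
    have h2 : (⟨(φ * elem z 1 * φ⁻¹ : Aut n K) ℓ, map_mem_without hcomm ℓ.2⟩ : without K z) = ℓ :=
      Subtype.ext hinv
    rw [h2, mul_inv_eq_iff_eq_mul] at h1
    exact h1
  have hβS := isAff_of_commute_elem hA hE (mul_mem (mul_mem (inv_mem hφ) hS) hφ) (hconj _ hcommS)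
  -- an affine invariant of the source translation on which the target translation is constant
  obtain ⟨h, hhw, hh, hhne, c, hc⟩ : ∃ h ∈ without K z, h ∈ affineFns n K ∧ (∀ c, h ≠ C c) ∧
      ∃ c, diff (φ⁻¹ * elem z 1 * φ) h = C c := by
    obtain ⟨i, hi⟩ : ∃ i : Fin n, i ≠ z := by
      have : Nontrivial (Fin n) := Fin.nontrivial_iff_two_le.mpr (by omega)
      exact exists_ne z
    obtain ⟨k, hk1, hk2⟩ := exists_last_notMem (diff (φ⁻¹ * elem z 1 * φ))
      (Set.range (C : K → MvPolynomial (Fin n) K)) (x := X i) (by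
        rintro ⟨c, hc⟩
        have := congrArg totalDegree hc
        simp at this) (by
        obtain ⟨k, hk⟩ := exists_conj_elem_one_diff_pow_eq_zero z φ⁻¹ (X i)
        rw [inv_inv, Module.End.pow_apply] at hk
        exact ⟨k, 0, by rw [hk, C_0]⟩)
    refine ⟨_, ?_, ?_, fun c hc => hk1 ⟨c, hc.symm⟩, ?_⟩
    · clear hk1 hk2
      induction k with
      | zero => exact X_mem_without hi
      | succ k ih =>
        rw [Function.iterate_succ_apply', diff_apply]
        exact sub_mem (map_mem_without hβ ih) ih
    · rw [← Module.End.pow_apply]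
      exact isAff_conj_diff_mem hβaff k (X_mem_affineFns i)
    · obtain ⟨c, hc⟩ := hk2
      rw [Function.iterate_succ_apply'] at hc
      exact ⟨c, hc.symm⟩
  have hTf : elem z 1 (φ h) = φ h + C c := by
    rw [← algEquiv_C φ c, ← hc, diff_apply, AlgEquiv.mul_apply, AlgEquiv.mul_apply, map_sub, hφ1]
    ring
  rcases eq_or_ne c 0 with rfl | hc0
  · exact false_of_map_invariant hA hE hφ haff htr hcomm ⟨h, hhw⟩ hh hhne (by simpa using hTf)
  · have hf0 : φ h - C c * X z ∈ without K z := by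
      apply mem_without_of_elem_one_eq
      rw [map_sub, hTf, map_mul, algEquiv_C, elem_X_self]
      push_cast
      ring
    have hSf : elem z ℓ (φ h) = φ h + C c * (ℓ : MvPolynomial (Fin n) K) := by
      have := elem_of_mem ℓ hf0
      rw [map_sub, map_mul, algEquiv_C, elem_X_self] at this
      linear_combination this
    have hℓ' : φ⁻¹ ℓ ∈ affineFns n K := by
      have h1 := Submodule.sub_mem _ (hβS.map_mem hh) hh
      rw [AlgEquiv.mul_apply, AlgEquiv.mul_apply, hSf, map_add, hφ2, add_sub_cancel_left, map_mul,
        algEquiv_C] at h1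
      have h2 := Submodule.smul_mem _ c⁻¹ h1
      rwa [smul_eq_C_mul, ← mul_assoc, ← C_mul, inv_mul_cancel₀ hc0, C_1, one_mul] at h2
    -- Invariance of `ℓ` under the conjugated translation is invariance of `φ⁻¹ ℓ` under `elem z 1`.
    have hℓw : φ⁻¹ ℓ ∈ without K z := by
      apply mem_without_of_elem_one_eq
      apply φ.injective
      rw [hφ1, ← AlgEquiv.mul_apply, ← AlgEquiv.mul_apply]
      exact hinv
    exact false_of_map_invariant hA hE hφ haff htr hcomm ⟨_, hℓw⟩ hℓ'
      (fun c hc => hne c ((map_eq_C_iff φ⁻¹).mp hc)) (by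
        simp only [hφ1]
        exact elem_of_mem _ ℓ.2)

end

end

section

/-! ### Shift-invariant spaces of polynomials in one variable -/

section Shift

variable {K : Type*} [Field K]

variable (K) in
/-- The shift `p(t) ↦ p(t + 1)`. -/
noncomputable def shift : Polynomial K →ₐ[K] Polynomial K :=
  Polynomial.aeval (Polynomial.X + 1)

theorem shift_X_pow (k : ℕ) :
    shift K (Polynomial.X ^ k) = (Polynomial.X + 1) ^ k := by
  simp [shift]

theorem coeff_shift {p : Polynomial K} {N : ℕ} (hp : p.natDegree < N) (d : ℕ) :
    (shift K p).coeff d = ∑ k ∈ Finset.range N, p.coeff k * (k.choose d : K) := by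
  conv_lhs => rw [p.as_sum_range' N hp]
  rw [map_sum, Polynomial.finsetSum_coeff]
  refine Finset.sum_congr rfl fun k _ => ?_
  rw [← Polynomial.C_mul_X_pow_eq_monomial, map_mul, shift_X_pow, ← Polynomial.algebraMap_eq,
    AlgHom.commutes, Polynomial.algebraMap_eq, Polynomial.coeff_C_mul,
    Polynomial.coeff_X_add_one_pow]

/-- In characteristic zero the difference `p(t + 1) - p(t)` has degree exactly one less. By
induction the space contains all lower degrees, hence also the leading power of `p`. -/
theorem degreeLT_le_of_shift [CharZero K] {W : Submodule K (Polynomial K)}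
    (hW : ∀ p ∈ W, shift K p ∈ W) (d : ℕ) :
    ∀ p ∈ W, p ≠ 0 → p.natDegree = d → Polynomial.degreeLT K (d + 1) ≤ W := by
  induction d with
  | zero =>
    intro p hp h0 hd q hq
    obtain ⟨a, rfl⟩ := Polynomial.natDegree_eq_zero.mp hd
    have ha : a ≠ 0 := fun h => h0 (by simp [h])
    have hq' : q.natDegree = 0 := by
      rw [Polynomial.mem_degreeLT, Polynomial.degree_lt_iff_coeff_zero] at hq
      exact Nat.le_zero.mp (Polynomial.natDegree_le_iff_coeff_eq_zero.mpr fun k hk => hq k hk)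
    obtain ⟨b, rfl⟩ := Polynomial.natDegree_eq_zero.mp hq'
    have := W.smul_mem (b * a⁻¹) hp
    rwa [Polynomial.smul_C, smul_eq_mul, mul_assoc, inv_mul_cancel₀ ha, mul_one] at this
  | succ d ih =>
    intro p hp h0 hd
    have hlt : p.natDegree < d + 2 := by omega
    have hlead : p.coeff (d + 1) ≠ 0 := by
      rw [← hd]
      exact Polynomial.leadingCoeff_ne_zero.mpr h0
    have hc : ∀ k, d < k → (shift K p - p).coeff k = 0 := by
      intro k hk
      rw [Polynomial.coeff_sub, coeff_shift hlt]
      rcases Nat.lt_or_ge (d + 1) k with h | h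
      · rw [Polynomial.coeff_eq_zero_of_natDegree_lt (by omega), sub_zero]
        refine Finset.sum_eq_zero fun j hj => ?_
        rw [Nat.choose_eq_zero_of_lt (by rw [Finset.mem_range] at hj; omega)]
        simp
      · obtain rfl : k = d + 1 := by omega
        rw [Finset.sum_range_succ, Finset.sum_eq_zero]
        · simp
        · intro j hj
          rw [Nat.choose_eq_zero_of_lt (by rw [Finset.mem_range] at hj; omega)]
          simp
    have hcd : (shift K p - p).coeff d = p.coeff (d + 1) * (d + 1) := by
      rw [Polynomial.coeff_sub, coeff_shift hlt, Finset.sum_range_succ, Finset.sum_range_succ,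
        Finset.sum_eq_zero]
      · simp
      · intro j hj
        rw [Nat.choose_eq_zero_of_lt (by rw [Finset.mem_range] at hj; omega)]
        simp
    have hcd0 : (shift K p - p).coeff d ≠ 0 := by
      rw [hcd]
      exact mul_ne_zero hlead (by exact_mod_cast Nat.succ_ne_zero d)
    have hdeg : (shift K p - p).natDegree = d :=
      le_antisymm (Polynomial.natDegree_le_iff_coeff_eq_zero.mpr hc)
        (Polynomial.le_natDegree_of_ne_zero hcd0)
    have h1 := ih _ (W.sub_mem (hW p hp) hp) (fun h => hcd0 (by simp [h])) hdeg
    have hX : Polynomial.X ^ (d + 1) ∈ W := by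
      have h2 : p - Polynomial.C (p.coeff (d + 1)) * Polynomial.X ^ (d + 1) ∈ W := by
        apply h1
        rw [Polynomial.mem_degreeLT, Polynomial.degree_lt_iff_coeff_zero]
        intro k hk
        rcases eq_or_lt_of_le hk with rfl | hk
        · simp
        · rw [Polynomial.coeff_sub, Polynomial.coeff_C_mul_X_pow, if_neg (by omega),
            Polynomial.coeff_eq_zero_of_natDegree_lt (by omega), sub_zero]
      have h3 := W.sub_mem hp h2
      rw [sub_sub_cancel, ← Polynomial.smul_eq_C_mul] at h3
      simpa [smul_smul, inv_mul_cancel₀ hlead] using W.smul_mem (p.coeff (d + 1))⁻¹ h3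
    intro q hq
    rw [Polynomial.mem_degreeLT, Polynomial.degree_lt_iff_coeff_zero] at hq
    have h2 : q - Polynomial.C (q.coeff (d + 1)) * Polynomial.X ^ (d + 1) ∈ W := by
      apply h1
      rw [Polynomial.mem_degreeLT, Polynomial.degree_lt_iff_coeff_zero]
      intro k hk
      rcases eq_or_lt_of_le hk with rfl | hk
      · simp
      · rw [Polynomial.coeff_sub, Polynomial.coeff_C_mul_X_pow, if_neg (by omega),
          hq k (by omega), sub_zero]
    have h3 := W.add_mem h2 (W.smul_mem (q.coeff (d + 1)) hX)
    rwa [Polynomial.smul_eq_C_mul, sub_add_cancel] at h3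

/-- The only shift-invariant space of polynomials of dimension `N` is the space of polynomials
of degree less than `N`. -/
theorem eq_degreeLT_of_shift [CharZero K] {W : Submodule K (Polynomial K)}
    [FiniteDimensional K W] (hW : ∀ p ∈ W, shift K p ∈ W) {N : ℕ}
    (hN : Module.finrank K W = N) : W = Polynomial.degreeLT K N := by
  have hfin : ∀ d, Module.finrank K (Polynomial.degreeLT K d) = d := fun d => by
    rw [(Polynomial.degreeLTEquiv K d).finrank_eq]
    simp
  have hfd : ∀ d, FiniteDimensional K (Polynomial.degreeLT K d) := fun d =>
    Module.Finite.equiv (Polynomial.degreeLTEquiv K d).symm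
  have := hfd N
  refine Submodule.eq_of_le_of_finrank_eq ?_ (hN.trans (hfin N).symm)
  intro p hp
  rcases eq_or_ne p 0 with rfl | h0
  · exact zero_mem _
  have h1 := Submodule.finrank_mono (degreeLT_le_of_shift hW _ p hp h0 rfl)
  rw [hfin, hN] at h1
  rw [Polynomial.mem_degreeLT]
  exact (Polynomial.natDegree_lt_iff_degree_lt h0).mp (by omega)

end Shift

/-! ### Moment-curve coordinates for a single Jordan block -/

variable {n : ℕ} {K : Type*} [Field K]

variable (n K) in
theorem finrank_affineFns : Module.finrank K (affineFns n K) = n + 1 := by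
  have hli : LinearIndependent K
      (fun o : Option (Fin n) => o.elim (1 : MvPolynomial (Fin n) K) X) := by
    have h := (basisMonomials (Fin n) K).linearIndependent.comp
      (fun o : Option (Fin n) => o.elim (0 : Fin n →₀ ℕ) fun i => Finsupp.single i 1) (by
        rintro (_ | i) (_ | j) h
        · rfl
        · simp [eq_comm] at h
        · simp at h
        · simpa [Finsupp.single_left_inj] using h)
    have e : (fun o : Option (Fin n) => o.elim (1 : MvPolynomial (Fin n) K) X) =
        basisMonomials (Fin n) K ∘ fun o => o.elim 0 fun i => Finsupp.single i 1 := by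
      funext o
      cases o <;> simp [X]
    rw [e]
    exact h
  have hr : Set.range (fun o : Option (Fin n) => o.elim (1 : MvPolynomial (Fin n) K) X) =
      insert 1 (Set.range X) := by
    ext P
    constructor
    · rintro ⟨_ | i, rfl⟩
      · exact Or.inl rfl
      · exact Or.inr ⟨i, rfl⟩
    · rintro (rfl | ⟨i, rfl⟩)
      · exact ⟨none, rfl⟩
      · exact ⟨some i, rfl⟩
  have := finrank_span_eq_card hli
  rw [hr, ← affineFns_eq_span] at this
  simpa using this

/-- If the affine automorphism `A` is conjugate to a translation and has no affine invariants
other than the constants, then in suitable affine coordinates an orbit of its flow is the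
moment curve. -/
theorem exists_moment_coordinates [CharZero K] {z : Fin n} {φ A : Aut n K}
    (hφ : φ * elem z 1 * φ⁻¹ = A) (hA : IsAff A)
    (hconst : ∀ ℓ ∈ affineFns n K, A ℓ = ℓ → ∃ c, ℓ = C c) :
    ∃ (l : Aut n K) (G : MvPolynomial (Fin n) K →ₐ[K] Polynomial K), IsAff l ∧
      (∀ i : Fin n, G (X i) = Polynomial.X ^ ((i : ℕ) + 1)) ∧
      (∀ P ∈ affineFns n K, G P = 0 → P = 0) ∧
      ∀ P, G ((l⁻¹ * A * l) P) = shift K (G P) := by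
  classical
  -- Restriction to the `x_z`-axis, an orbit line of the translation. Composed with `φ⁻¹` it
  -- restricts functions to a curve on which `A` acts as the shift of the parameter.
  let Γ₀ : MvPolynomial (Fin n) K →ₐ[K] Polynomial K :=
    aeval fun i => if i = z then Polynomial.X else 0
  have hΓ₀ : ∀ P, Γ₀ (elem z 1 P) = shift K (Γ₀ P) := by
    intro P
    have : Γ₀.comp ((elem z 1 : Aut n K) : MvPolynomial (Fin n) K →ₐ[K] _) = (shift K).comp Γ₀ := by
      refine MvPolynomial.algHom_ext fun i => ?_
      rcases eq_or_ne i z with rfl | hi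
      · simp [Γ₀, shift]
      · simp [Γ₀, hi, elem_X_of_ne hi]
    exact DFunLike.congr_fun this P
  let Γ : MvPolynomial (Fin n) K →ₐ[K] Polynomial K := Γ₀.comp (φ⁻¹ : Aut n K)
  have hΓ : ∀ P, Γ (A P) = shift K (Γ P) := by
    intro P
    have h1 : φ⁻¹ (A P) = elem z 1 (φ⁻¹ P) := by
      rw [← hφ, ← AlgEquiv.mul_apply, ← AlgEquiv.mul_apply]
      congr 1
      group
    change Γ₀ (φ⁻¹ (A P)) = shift K (Γ₀ (φ⁻¹ P))
    rw [h1, hΓ₀]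
  -- A nonzero affine function vanishing on the curve would have a last nonzero difference, which is
  -- invariant and hence a nonzero constant, yet still vanishes on the curve.
  have hinj : ∀ P ∈ affineFns n K, Γ P = 0 → P = 0 := by
    intro P hP h0
    by_contra hne
    obtain ⟨k, hk1, hk2⟩ := exists_last_notMem (diff A) {0} (x := P) hne (by
      obtain ⟨k, hk⟩ := exists_conj_elem_one_diff_pow_eq_zero z φ P
      rw [hφ, Module.End.pow_apply] at hk
      exact ⟨k, hk⟩)
    rw [Function.iterate_succ_apply', Set.mem_singleton_iff, diff_eq_zero] at hk2
    have h1 : (diff A)^[k] P ∈ affineFns n K := by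
      rw [← Module.End.pow_apply]
      exact isAff_conj_diff_mem hA k hP
    obtain ⟨c, hc⟩ := hconst _ h1 hk2
    have h2 : ∀ k, Γ ((diff A)^[k] P) = 0 := by
      intro k
      induction k with
      | zero => exact h0
      | succ k ih =>
        rw [Function.iterate_succ_apply', diff_apply, map_sub, hΓ, ih, map_zero, sub_zero]
    have h3 := h2 k
    rw [hc, ← MvPolynomial.algebraMap_eq, AlgHom.commutes] at h3
    have h4 : c = 0 := by simpa using h3
    rw [hc, h4, C_0] at hk1
    exact hk1 rfl
  let W : Submodule K (Polynomial K) := LinearMap.range (Γ.toLinearMap.domRestrict (affineFns n K))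
  have hmemW : ∀ P ∈ affineFns n K, Γ P ∈ W := fun P hP => ⟨⟨P, hP⟩, rfl⟩
  -- The restrictions of affine functions form a shift-invariant space of dimension `n + 1`, so
  -- every power of `t` up to `n` is the restriction of an affine function.
  have hW : W = Polynomial.degreeLT K (n + 1) := by
    apply eq_degreeLT_of_shift
    · rintro _ ⟨P, rfl⟩
      have := hmemW _ (hA.map_mem P.2)
      rwa [hΓ] at this
    · rw [LinearMap.finrank_range_of_inj, finrank_affineFns]
      rw [← LinearMap.ker_eq_bot, LinearMap.ker_eq_bot']
      exact fun P hP => Subtype.ext (hinj P P.2 hP)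
  have hy : ∀ i : Fin n, ∃ y ∈ affineFns n K, Γ y = Polynomial.X ^ ((i : ℕ) + 1) := by
    intro i
    have : (Polynomial.X ^ ((i : ℕ) + 1) : Polynomial K) ∈ W := by
      rw [hW, Polynomial.mem_degreeLT, Polynomial.degree_X_pow]
      exact_mod_cast Nat.succ_lt_succ i.2
    obtain ⟨y, hy⟩ := this
    exact ⟨y, y.2, hy⟩
  choose y hyA hyΓ using hy
  have hspan : Submodule.span K (insert 1 (Set.range y)) ≤ affineFns n K := by
    rw [Submodule.span_le]
    rintro _ (rfl | ⟨i, rfl⟩)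
    exacts [one_mem_affineFns, hyA i]
  obtain ⟨l, hl⟩ := exists_algEquiv_of_span y fun j => by
    have h1 : Polynomial.degreeLT K (n + 1) ≤
        (Submodule.span K (insert 1 (Set.range y))).map Γ.toLinearMap := by
      rw [Polynomial.degreeLT_eq_span_X_pow, Submodule.span_le]
      intro p hp
      simp only [Finset.coe_image, Set.mem_image, Finset.mem_coe, Finset.mem_range] at hp
      obtain ⟨k, hk, rfl⟩ := hp
      rcases k with _ | k
      · exact ⟨1, Submodule.subset_span (Or.inl rfl), by simp⟩
      · exact ⟨y ⟨k, by omega⟩, Submodule.subset_span (Or.inr ⟨_, rfl⟩), hyΓ _⟩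
    obtain ⟨Q, hQ, hQΓ⟩ := h1 (hW ▸ hmemW _ (X_mem_affineFns j))
    have h2 := hinj (Q - X j) (Submodule.sub_mem _ (hspan hQ) (X_mem_affineFns j)) (by
      rw [map_sub, sub_eq_zero]
      exact hQΓ)
    rwa [← sub_eq_zero.mp h2]
  have hlA : IsAff l := fun i => hl i ▸ hyA i
  refine ⟨l, Γ.comp (l : MvPolynomial (Fin n) K →ₐ[K] _), hlA, fun i => ?_, fun P hP h => ?_,
    fun P => ?_⟩
  · rw [AlgHom.comp_apply, AlgEquiv.coe_toAlgHom, hl, hyΓ]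
  · have := hinj _ (hlA.map_mem hP) h
    simpa using this
  · change Γ (l ((l⁻¹ * A * l) P)) = shift K (Γ (l P))
    rw [← hΓ, ← AlgEquiv.mul_apply, ← AlgEquiv.mul_apply]
    congr 2
    group

end

section

variable {n : ℕ} {K : Type*} [Field K]

/-! ### Linear terms at the origin -/

theorem coeff_single_mul (j : Fin n) (P Q : MvPolynomial (Fin n) K) :
    coeff (Finsupp.single j 1) (P * Q) =
      coeff 0 P * coeff (Finsupp.single j 1) Q + coeff (Finsupp.single j 1) P * coeff 0 Q := by
  rw [coeff_mul, Finsupp.antidiagonal_single]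
  simp [Finset.Nat.antidiagonal_succ]

/-- The differentials at the origin of the components of an automorphism separate two
coordinate directions. -/
theorem exists_coeff_single_ne_zero (φ : Aut n K) (z : Fin n) {a b : Fin n} (hab : a ≠ b) :
    ∃ i, i ≠ z ∧ (coeff (Finsupp.single a 1) (φ (X i)) ≠ 0 ∨
      coeff (Finsupp.single b 1) (φ (X i)) ≠ 0) := by
  classical
  have key : ∀ x y : K, (∀ i, x * coeff (Finsupp.single a 1) (φ (X i)) +
      y * coeff (Finsupp.single b 1) (φ (X i)) = 0) → x = 0 ∧ y = 0 := by
    intro x y h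
    have h1 : ∀ P, x * coeff (Finsupp.single a 1) (φ P) +
        y * coeff (Finsupp.single b 1) (φ P) = 0 := by
      intro P
      induction P using MvPolynomial.induction_on with
      | C c => simp [algEquiv_C, coeff_C, eq_comm]
      | add P Q hP hQ =>
        rw [map_add, coeff_add, coeff_add]
        linear_combination hP + hQ
      | mul_X P i hP =>
        rw [map_mul, coeff_single_mul, coeff_single_mul]
        linear_combination coeff 0 (φ P) * h i + coeff 0 (φ (X i)) * hP
    have h2 : ∀ P, x * coeff (Finsupp.single a 1) P + y * coeff (Finsupp.single b 1) P = 0 := by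
      intro P
      have := h1 (φ⁻¹ P)
      rwa [← AlgEquiv.mul_apply, mul_inv_cancel, AlgEquiv.one_apply] at this
    have ha := h2 (X a)
    have hb := h2 (X b)
    simp only [coeff_X, Finsupp.single_left_inj one_ne_zero, hab, hab.symm, if_true, if_false,
      mul_one, mul_zero, add_zero, zero_add] at ha hb
    exact ⟨ha, hb⟩
  by_contra! h
  -- If only `φ x_z` had coefficients in the directions `a` and `b`, this combination would kill
  -- them as well. So they vanish too, and `(1, 0)` is then a forbidden relation.
  have h1 := key (coeff (Finsupp.single b 1) (φ (X z))) (-coeff (Finsupp.single a 1) (φ (X z)))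
    (fun i => by
      rcases eq_or_ne i z with rfl | hi
      · ring
      · rw [(h i hi).1, (h i hi).2]
        ring)
  have h2 := key 1 0 (fun i => by
    rcases eq_or_ne i z with rfl | hi
    · rw [neg_eq_zero.mp h1.2]
      ring
    · rw [(h i hi).1]
      ring)
  exact one_ne_zero h2.1

/-! ### Weights -/

/-- The weight that gives the `i`-th variable (counted from `1`) weight `i`. -/
def wt (i : Fin n) : ℕ := (i : ℕ) + 1

theorem weight_wt (m : Fin n →₀ ℕ) : Finsupp.weight wt m = ∑ i, m i * wt i := by
  rw [Finsupp.weight_apply, Finsupp.sum_fintype _ _ (by simp)]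
  rfl

theorem mul_wt_le (m : Fin n →₀ ℕ) (i : Fin n) : m i * wt i ≤ Finsupp.weight wt m := by
  rw [weight_wt]
  exact Finset.single_le_sum (f := fun i => m i * wt i) (fun _ _ => Nat.zero_le _)
    (Finset.mem_univ i)

theorem eq_single_of_weight_eq_one {m : Fin n →₀ ℕ} (h : Finsupp.weight wt m = 1) (i : Fin n)
    (hi : (i : ℕ) = 0) : m = Finsupp.single i 1 := by
  ext j
  have h1 := mul_wt_le m j
  rw [h] at h1
  rcases eq_or_ne j i with rfl | hj
  · rw [Finsupp.single_eq_same]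
    have hm : ∀ k ≠ j, m k = 0 := by
      intro k hk
      have h2 := mul_wt_le m k
      have : 2 ≤ wt k := by
        have : (k : ℕ) ≠ j := fun h => hk (Fin.ext h)
        unfold wt
        omega
      rw [h] at h2
      by_contra h0
      have : 1 ≤ m k := Nat.one_le_iff_ne_zero.mpr h0
      nlinarith
    rw [weight_wt, Finset.sum_eq_single j (fun k _ hk => by rw [hm k hk, zero_mul]) (by simp)] at h
    exact Nat.eq_one_of_mul_eq_one_right h
  · rw [Finsupp.single_eq_of_ne hj]
    have : 2 ≤ wt j := by
      have : (j : ℕ) ≠ i := fun h => hj (Fin.ext h)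
      unfold wt
      omega
    by_contra h0
    have : 1 ≤ m j := Nat.one_le_iff_ne_zero.mpr h0
    nlinarith

variable [CharZero K]

variable (n K) in
/-- The one-parameter subgroup with the weights `wt`, evaluated at `2`. -/
noncomputable def dilation : Aut n K := diag fun i => Units.mk0 2 two_ne_zero ^ wt i

theorem dilation_X (i : Fin n) : dilation n K (X i) = C (2 ^ wt i) * X i := by
  simp [dilation]

theorem dilation_of_isWeightedHomogeneous {P : MvPolynomial (Fin n) K} {k : ℕ}
    (hP : IsWeightedHomogeneous wt P k) : dilation n K P = (2 : K) ^ k • P := by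
  conv_lhs => rw [P.as_sum]
  conv_rhs => rw [P.as_sum]
  rw [map_sum, Finset.smul_sum]
  refine Finset.sum_congr rfl fun m hm => ?_
  rw [dilation, diag_monomial]
  congr 1
  rw [← hP (mem_support_iff.mp hm), weight_wt, ← Finset.prod_pow_eq_pow_sum]
  refine Finset.prod_congr rfl fun i _ => ?_
  rw [Units.val_pow_eq_pow_val, Units.val_mk0, ← pow_mul, mul_comm]

theorem weightedHomogeneousComponent_mem {U : Submodule K (MvPolynomial (Fin n) K)}
    (hU : ∀ P ∈ U, dilation n K P ∈ U) {P : MvPolynomial (Fin n) K} (hP : P ∈ U) (k : ℕ) :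
    weightedHomogeneousComponent wt k P ∈ U := by
  have hfin := weightedHomogeneousComponent_finsupp (w := wt) (φ := P)
  have h1 := mem_of_sum_mem_of_eigenvectors U (dilation n K).toLinearMap hU
    (fun k : ℕ => (2 : K) ^ k) hfin.toFinset (by
      intro k _ k' _ e
      have e' : ((2 ^ k : ℕ) : K) = (2 ^ k' : ℕ) := by push_cast; exact e
      exact Nat.pow_right_injective le_rfl (Nat.cast_injective e'))
    (fun k => weightedHomogeneousComponent wt k P)
    (fun k _ => dilation_of_isWeightedHomogeneous
      (weightedHomogeneousComponent_isWeightedHomogeneous k P))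
    (by rw [← finsum_eq_sum _ hfin, sum_weightedHomogeneousComponent]; exact hP)
  by_cases hk : weightedHomogeneousComponent wt k P = 0
  · rw [hk]
    exact zero_mem U
  · exact h1 k (hfin.mem_toFinset.mpr hk)

/-! ### Excluding affine automorphisms without nonconstant affine invariants -/

section

variable {H : Subgroup (Aut n K)}

/-- `b` and `d` both double the time, of the flow of `A` and of `t` respectively. After transport by
`φ` the two effects cancel. -/
theorem commute_of_conj_of_mul_eq_mul_sq {G : Type*} [Group G] {φ A t b d : G}
    (hφ : φ * t * φ⁻¹ = A) (hb : A * b = b * A ^ 2) (hd : t * d = d * t ^ 2) :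
    Commute (φ⁻¹ * b * φ * d⁻¹) t := by
  subst hφ
  have hd' : t ^ 2 * d⁻¹ = d⁻¹ * t := by
    rw [mul_inv_eq_iff_eq_mul, mul_assoc, hd, inv_mul_cancel_left]
  have hb' : t * (φ⁻¹ * b * φ) = φ⁻¹ * b * φ * t ^ 2 := by
    have := congrArg (fun x => φ⁻¹ * x * φ) hb
    simpa [pow_two, mul_assoc] using this
  change _ * t = t * _
  rw [← mul_assoc t, hb', mul_assoc _ (t ^ 2), hd', ← mul_assoc]

/-- The dilation transported by `φ`, divided by the doubling of `x_z`, commutes with the translation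
and is therefore affine. The doubling of `x_z` does not affect `h`. -/
theorem conj_dilation_mem (hA : ∀ α, IsAff α → α ∈ H)
    (hE : ∀ (z : Fin n) (h : without K z), elem z h ∈ H →
      (h : MvPolynomial (Fin n) K) ∈ affineFns n K)
    {z : Fin n} {φ A : Aut n K} (hφ : φ ∈ H)
    (hφA : φ * elem z 1 * φ⁻¹ = A) (hdil : A * dilation n K = dilation n K * A ^ 2)
    {h : MvPolynomial (Fin n) K} (h1 : h ∈ affineFns n K) (h2 : h ∈ without K z) :
    φ⁻¹ (dilation n K (φ h)) ∈ affineFns n K ∧ φ⁻¹ (dilation n K (φ h)) ∈ without K z := by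
  let u : Fin n → Kˣ := Function.update 1 z (Units.mk0 2 two_ne_zero)
  have hd : elem z 1 * diag u = diag u * elem z (1 : without K z) ^ 2 := by
    refine algEquiv_ext fun i => ?_
    rw [pow_two]
    simp only [AlgEquiv.mul_apply]
    rcases eq_or_ne i z with rfl | hi
    · simp [u, map_ofNat]
      ring
    · simp [elem_X_of_ne hi, u, hi]
  have hγ := commute_of_conj_of_mul_eq_mul_sq hφA hdil hd
  have hγaff : IsAff (φ⁻¹ * dilation n K * φ * (diag u)⁻¹) := isAff_of_commute_elem hA hE
    (mul_mem (mul_mem (mul_mem (inv_mem hφ) (hA _ (isAff_diag _))) hφ)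
      (inv_mem (hA _ (isAff_diag u)))) hγ
  have h3 : diag u h = h := diag_of_mem (fun i hi => by
    simp only [u]
    rw [Function.update_of_ne (by simpa using hi)]
    rfl) h2
  have h4 : φ⁻¹ (dilation n K (φ h)) = (φ⁻¹ * dilation n K * φ * (diag u)⁻¹) h := by
    have h5 : (diag u)⁻¹ h = h := by
      nth_rewrite 1 [← h3]
      rw [← AlgEquiv.mul_apply, inv_mul_cancel, AlgEquiv.one_apply]
    rw [AlgEquiv.mul_apply, AlgEquiv.mul_apply, AlgEquiv.mul_apply, h5]
  rw [h4]
  exact ⟨hγaff.map_mem h1, map_mem_without hγ h2⟩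

/-- The `φ`-images of affine functions free of `x_z` form a weight-graded space of invariants of
`A`. Invariance excludes a weight-one part, since `A` moves `x_o`. The differential of `φ` then
forces some image to have a nonzero weight-two part involving `x_j` linearly. This part cannot
contain the last variable, which has weight `n ≥ 3`, so `false_of_map_invariant` applies. -/
theorem false_of_dilation (hn : 3 ≤ n) (hA : ∀ α, IsAff α → α ∈ H)
    (hE : ∀ (z : Fin n) (h : without K z), elem z h ∈ H →
      (h : MvPolynomial (Fin n) K) ∈ affineFns n K)
    {z : Fin n} (hz : (z : ℕ) + 1 = n) {φ A : Aut n K} (hφ : φ ∈ H)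
    (hφA : φ * elem z 1 * φ⁻¹ = A) (haff : IsAff A) (htr : ∀ v, A ≠ trans v)
    (hcomm : Commute A (elem z 1)) (hdil : A * dilation n K = dilation n K * A ^ 2)
    {o : Fin n} (ho : (o : ℕ) = 0) (hAo : A (X o) = X o + 1) : False := by
  have hφ1 : ∀ P, φ (φ⁻¹ P) = P := fun P => by
    rw [← AlgEquiv.mul_apply, mul_inv_cancel, AlgEquiv.one_apply]
  have hφ2 : ∀ P, φ⁻¹ (φ P) = P := fun P => by
    rw [← AlgEquiv.mul_apply, inv_mul_cancel, AlgEquiv.one_apply]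
  -- the invariants of `A` that come from affine functions form a space with a weight grading
  let U : Submodule K (MvPolynomial (Fin n) K) :=
    (affineFns n K ⊓ (without K z).toSubmodule).comap φ⁻¹.toLinearMap
  have hUmem : ∀ P, P ∈ U ↔ φ⁻¹ P ∈ affineFns n K ∧ φ⁻¹ P ∈ without K z := fun P => Iff.rfl
  clear_value U
  have hUdil : ∀ P ∈ U, dilation n K P ∈ U := by
    intro P hP
    rw [hUmem] at hP ⊢
    have h1 := conj_dilation_mem hA hE hφ hφA hdil hP.1 hP.2
    rwa [hφ1] at h1
  have hUA : ∀ P ∈ U, A P = P := by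
    intro P hP
    rw [← hφA, AlgEquiv.mul_apply, AlgEquiv.mul_apply]
    have : elem z 1 (φ⁻¹ P) = φ⁻¹ P := elem_of_mem 1 ((hUmem P).mp hP).2
    rw [this, hφ1]
  have hU1 : ∀ P ∈ U, coeff (Finsupp.single o 1) P = 0 := by
    intro P hP
    have h1 := hUA _ (weightedHomogeneousComponent_mem hUdil hP 1)
    have hw : Finsupp.weight wt (Finsupp.single o 1) = 1 := by
      rw [Finsupp.weight_apply, Finsupp.sum_single_index (by simp)]
      simp [wt, ho]
    have h2 : weightedHomogeneousComponent wt 1 P = C (coeff (Finsupp.single o 1) P) * X o := by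
      classical
      ext m
      rw [coeff_weightedHomogeneousComponent, coeff_C_mul, coeff_X]
      split_ifs with h3 h4 h4
      · rw [h4, mul_one]
      · exact absurd (eq_single_of_weight_eq_one h3 o ho).symm h4
      · exact absurd (h4 ▸ hw) h3
      · rw [mul_zero]
    rw [h2, map_mul, algEquiv_C, hAo, mul_add, mul_one, add_eq_left] at h1
    simpa using h1
  obtain ⟨j, hj⟩ : ∃ j : Fin n, (j : ℕ) = 1 := ⟨⟨1, by omega⟩, rfl⟩
  obtain ⟨i, hi, hij⟩ := exists_coeff_single_ne_zero φ z (a := o) (b := j) (by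
    rintro rfl
    omega)
  have hiU : φ (X i) ∈ U := by
    rw [hUmem, hφ2]
    exact ⟨X_mem_affineFns i, X_mem_without hi⟩
  rw [or_iff_right (not_not.mpr (hU1 _ hiU))] at hij
  set f := weightedHomogeneousComponent wt 2 (φ (X i)) with hf
  have hfU : f ∈ U := weightedHomogeneousComponent_mem hUdil hiU 2
  have hwj : Finsupp.weight wt (Finsupp.single j 1) = 2 := by
    rw [Finsupp.weight_apply, Finsupp.sum_single_index (by simp)]
    simp [wt, hj]
  have hfne : ∀ c, f ≠ C c := by
    classical
    intro c hc
    have h1 := congrArg (coeff (Finsupp.single j 1)) hc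
    rw [hf, coeff_weightedHomogeneousComponent, if_pos hwj, coeff_C, if_neg (by simp [eq_comm])]
      at h1
    exact hij h1
  have hfz : f ∈ without K z := by
    refine mem_supported.mpr fun k hk => ?_
    obtain ⟨m, hm, hk⟩ := (mem_vars_iff_mem_support k).mp hk
    rintro rfl
    have h1 := weightedHomogeneousComponent_isWeightedHomogeneous 2 (φ (X i))
      (mem_support_iff.mp hm)
    have h2 := mul_wt_le m k
    rw [h1, wt, hz] at h2
    have : 1 ≤ m k := Nat.one_le_iff_ne_zero.mpr (Finsupp.mem_support_iff.mp hk)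
    nlinarith
  subst hφA
  exact false_of_map_invariant hA hE hφ haff htr hcomm ⟨φ⁻¹ f, ((hUmem f).mp hfU).2⟩
    ((hUmem f).mp hfU).1
    (fun c hc => hfne c ((map_eq_C_iff φ⁻¹).mp hc)) (by
      simp only [hφ1]
      exact elem_of_mem 1 hfz)

theorem false_of_invariants_const (hn : 3 ≤ n) (hA : ∀ α, IsAff α → α ∈ H)
    (hE : ∀ (z : Fin n) (h : without K z), elem z h ∈ H →
      (h : MvPolynomial (Fin n) K) ∈ affineFns n K)
    {z : Fin n} (hz : (z : ℕ) + 1 = n) {φ A : Aut n K} (hφ : φ ∈ H)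
    (hφA : φ * elem z 1 * φ⁻¹ = A) (haff : IsAff A) (htr : ∀ v, A ≠ trans v)
    (hconst : ∀ ℓ ∈ affineFns n K, A ℓ = ℓ → ∃ c, ℓ = C c) : False := by
  obtain ⟨l, G, hl, hGX, hGinj, hGA⟩ := exists_moment_coordinates hφA haff hconst
  set B := l⁻¹ * A * l with hB
  have hBaff : IsAff B := (hl.inv.mul haff).mul hl
  have hGeq : ∀ P ∈ affineFns n K, ∀ Q ∈ affineFns n K, G P = G Q → P = Q := by
    intro P hP Q hQ h
    exact sub_eq_zero.mp (hGinj _ (Submodule.sub_mem _ hP hQ) (by rw [map_sub, h, sub_self]))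
  have hGdil : ∀ P, G (dilation n K P) =
      Polynomial.aeval (2 * Polynomial.X : Polynomial K) (G P) := by
    intro P
    have : G.comp (dilation n K : MvPolynomial (Fin n) K →ₐ[K] _) =
        (Polynomial.aeval (2 * Polynomial.X : Polynomial K)).comp G := by
      refine MvPolynomial.algHom_ext fun i => ?_
      simp only [AlgHom.comp_apply, AlgEquiv.coe_toAlgHom, dilation_X, map_mul, hGX, map_pow,
        Polynomial.aeval_X, wt, map_ofNat]
      rw [mul_pow]
    exact DFunLike.congr_fun this P
  refine false_of_dilation hn hA hE hz (φ := l⁻¹ * φ) (A := B)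
    (mul_mem (inv_mem (hA _ hl)) hφ) ?_ hBaff ?_ ?_ ?_ (o := ⟨0, by omega⟩) rfl ?_
  · rw [hB, ← hφA]
    group
  · intro v hv
    have h1 : A = l * trans v * l⁻¹ := by
      rw [← hv, hB]
      group
    have h2 := hl.inv.inv_mul_trans_mul v
    rw [inv_inv, ← h1] at h2
    exact htr _ h2
  -- On the moment curve, the derivative along the last variable reads off the coefficient of `t^n`,
  -- and the shift preserves that coefficient in degrees at most `n`.
  · have hcoef : ∀ P ∈ affineFns n K, dirDeriv (Pi.single z 1) P = (G P).coeff n := by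
      intro P hP
      refine eqOn_affineFns (f := dirDeriv (Pi.single z 1))
        (g := (Polynomial.lcoeff K n).comp G.toLinearMap) ?_ ?_ hP
      · have := dirDeriv_C (Pi.single z (1 : K)) 1
        rw [C_1] at this
        rw [this]
        simp [Polynomial.coeff_one]
        omega
      · intro i
        rw [dirDeriv_X, LinearMap.comp_apply, AlgHom.toLinearMap_apply, hGX,
          Polynomial.lcoeff_apply, Polynomial.coeff_X_pow]
        rcases eq_or_ne i z with rfl | hi
        · simp [hz]
        · have : n ≠ (i : ℕ) + 1 := fun h => hi (Fin.ext (by omega))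
          simp [hi, this]
    change B * elem z 1 = elem z 1 * B
    refine algEquiv_ext fun i => ?_
    rw [elem_one_eq_trans, AlgEquiv.mul_apply B, AlgEquiv.mul_apply _ B,
      trans_of_mem _ (hBaff.map_mem (X_mem_affineFns i)),
      hcoef _ (hBaff.map_mem (X_mem_affineFns i)), trans_of_mem _ (X_mem_affineFns i),
      hcoef _ (X_mem_affineFns i), map_add, algEquiv_C, hGA, hGX,
      shift_X_pow, Polynomial.coeff_X_add_one_pow, Polynomial.coeff_X_pow]
    congr 2
    rcases eq_or_ne i z with rfl | hi
    · simp [hz]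
    · have h1 : n ≠ (i : ℕ) + 1 := fun h => hi (Fin.ext (by omega))
      rw [if_neg h1, Nat.choose_eq_zero_of_lt (by omega), Nat.cast_zero]
  -- On the curve the dilation is `t ↦ 2t`, and both sides send `t` to `2t + 2`.
  · refine algEquiv_ext fun i => ?_
    refine hGeq _ ?_ _ ?_ ?_
    · exact (hBaff.mul (isAff_diag _)).map_mem (X_mem_affineFns i)
    · rw [pow_two]
      exact ((isAff_diag _).mul (hBaff.mul hBaff)).map_mem (X_mem_affineFns i)
    · rw [AlgEquiv.mul_apply, hGA, hGdil, hGX, AlgEquiv.mul_apply, hGdil, pow_two,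
        AlgEquiv.mul_apply, hGA, hGA, hGX]
      simp only [map_pow, shift, Polynomial.aeval_X, map_mul, map_add, map_one, map_ofNat]
      congr 1
      ring
  · refine hGeq _ (hBaff.map_mem (X_mem_affineFns _)) _
      (Submodule.add_mem _ (X_mem_affineFns _) one_mem_affineFns) ?_
    rw [hGA, hGX, map_add, hGX, map_one, shift_X_pow]
    simp

end

end

/-! ### Automorphisms that conjugate a translation to an affine automorphism -/

section

variable {n : ℕ} {K : Type*} [Field K]

theorem eq_C_of_coeff_single_eq_zero {P : MvPolynomial (Fin n) K} (hP : P ∈ affineFns n K)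
    (h : ∀ j, coeff (Finsupp.single j 1) P = 0) : P = C (coeff 0 P) := by
  classical
  have := eqOn_affineFns (f := LinearMap.id)
    (g := (Algebra.linearMap K (MvPolynomial (Fin n) K)).comp (lcoeff K 0) +
      ∑ j, (lcoeff K (Finsupp.single j 1)).smulRight (X j)) (by
        simp [coeff_one, eq_comm]) (fun i => by
        simp [coeff_X, Finsupp.single_left_inj]) hP
  rw [LinearMap.id_apply] at this
  conv_lhs => rw [this]
  simp [h, MvPolynomial.algebraMap_eq]

/-- An affine automorphism with locally nilpotent difference operator which is not a translation
commutes with a translation that fixes all of its affine invariants. -/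
theorem exists_trans_commute {A : Aut n K} (hA : IsAff A) (htr : ∀ v, A ≠ trans v)
    (hnil : ∀ P, ∃ k, (diff A ^ k) P = 0) :
    ∃ v, v ≠ 0 ∧ Commute A (trans v) ∧ ∀ ℓ ∈ affineFns n K, A ℓ = ℓ → trans v ℓ = ℓ := by
  obtain ⟨k, ⟨i, hi⟩, hk⟩ := exists_last_diff_of_ne_trans htr hnil
  obtain ⟨j, hj⟩ : ∃ j, coeff (Finsupp.single j 1) ((diff A ^ (k + 1)) (X i)) ≠ 0 := by
    by_contra! h
    exact hi _ (eq_C_of_coeff_single_eq_zero (isAff_conj_diff_mem hA _ (X_mem_affineFns i)) h)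
  -- A coefficient of the last nonconstant difference is a linear functional killing constants, thus
  -- a derivative in some direction `v`. It kills differences of affine functions, so the
  -- translation commutes with `A`. It factors through `A - 1`, so the translation fixes the affine
  -- invariants.
  let v : Fin n → K := fun i => coeff (Finsupp.single j 1) ((diff A ^ (k + 1)) (X i))
  have hv : ∀ P ∈ affineFns n K,
      dirDeriv v P = coeff (Finsupp.single j 1) ((diff A ^ (k + 1)) P) := by
    intro P hP
    refine eqOn_affineFns (f := dirDeriv v)
      (g := (lcoeff K (Finsupp.single j 1)).comp (diff A ^ (k + 1))) ?_ (fun i => ?_) hP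
    · have h1 := dirDeriv_C v 1
      rw [C_1] at h1
      rw [h1, LinearMap.comp_apply, pow_succ, Module.End.mul_apply, diff_apply, map_one, sub_self,
        map_zero, map_zero]
    · rw [dirDeriv_X]
      rfl
  refine ⟨v, fun h => hj (congrFun h i), ?_, ?_⟩
  · refine algEquiv_ext fun m => ?_
    obtain ⟨c, hc⟩ := hk m
    have h1 : dirDeriv v (diff A (X m)) = 0 := by
      have h2 : diff A (X m) ∈ affineFns n K := Submodule.sub_mem _ (hA m) (X_mem_affineFns m)
      rw [hv _ h2, ← Module.End.mul_apply,
        ← pow_succ, hc]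
      classical
      rw [coeff_C, if_neg (by simp [eq_comm])]
    rw [diff_apply, map_sub, sub_eq_zero] at h1
    rw [AlgEquiv.mul_apply, AlgEquiv.mul_apply, trans_of_mem v (hA m), h1, dirDeriv_X, trans_X,
      map_add, algEquiv_C]
  · intro ℓ hℓ h
    rw [trans_of_mem v hℓ, hv ℓ hℓ, pow_succ, Module.End.mul_apply, diff_eq_zero.mpr h, map_zero,
      coeff_zero, C_0, add_zero]

section

variable [CharZero K] {H : Subgroup (Aut n K)}

theorem isAff_of_isAff_conj_elem (hn : 3 ≤ n) (hA : ∀ α, IsAff α → α ∈ H)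
    (hE : ∀ (z : Fin n) (h : without K z), elem z h ∈ H →
      (h : MvPolynomial (Fin n) K) ∈ affineFns n K)
    {z : Fin n} (hz : (z : ℕ) + 1 = n) {φ : Aut n K} (hφ : φ ∈ H)
    (haff : IsAff (φ * elem z 1 * φ⁻¹)) : IsAff φ := by
  by_cases htr : ∃ w, φ * elem z 1 * φ⁻¹ = trans w
  · obtain ⟨w, hw⟩ := htr
    have hw0 : w ≠ 0 := by
      rintro rfl
      rw [trans_zero, mul_inv_eq_one, mul_eq_left, elem_one_eq_trans, ← trans_zero] at hw
      have := congrFun (trans_injective hw) z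
      simp at this
    obtain ⟨l, hl, hlw⟩ := exists_conj_trans z hw0
    have hc : Commute (l⁻¹ * φ) (elem z 1) := by
      change _ * _ = _ * _
      rw [← hw] at hlw
      nth_rewrite 2 [← hlw]
      group
    have h1 := isAff_of_commute_elem hA hE (mul_mem (inv_mem (hA _ hl)) hφ) hc
    exact (hl.inv.mul_left_iff).mp h1
  · exfalso
    push Not at htr
    by_cases hconst : ∀ ℓ ∈ affineFns n K, (φ * elem z 1 * φ⁻¹ : Aut n K) ℓ = ℓ → ∃ c, ℓ = C c
    · exact false_of_invariants_const hn hA hE hz hφ rfl haff htr hconst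
    · push Not at hconst
      obtain ⟨ℓ, hℓ, hinv, hne⟩ := hconst
      -- An affine change of coordinates on the target turns this translation into `elem z 1`, so
      -- the source and target translations have the same form.
      obtain ⟨v, hv0, hcomm, hv⟩ := exists_trans_commute haff htr
        (exists_conj_elem_one_diff_pow_eq_zero z φ)
      obtain ⟨l, hl, hlv⟩ := exists_conj_trans z hv0
      have hconj : l⁻¹ * φ * elem z 1 * (l⁻¹ * φ)⁻¹ = l⁻¹ * (φ * elem z 1 * φ⁻¹) * l := by group
      have hll : ∀ P, l (l⁻¹ P) = P := fun P => by
        rw [← AlgEquiv.mul_apply, mul_inv_cancel, AlgEquiv.one_apply]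
      have hℓw : l⁻¹ ℓ ∈ without K z := by
        apply mem_without_of_elem_one_eq
        rw [← hlv, AlgEquiv.mul_apply, AlgEquiv.mul_apply, hll, hv ℓ hℓ hinv]
      refine false_of_invariant_affine hn hA hE (z := z) (φ := l⁻¹ * φ)
        (mul_mem (inv_mem (hA _ hl)) hφ) ?_ ?_ ?_ ⟨l⁻¹ ℓ, hℓw⟩ (hl.inv.map_mem hℓ)
        (fun c hc => hne c ((map_eq_C_iff l⁻¹).mp hc)) ?_
      · rw [hconj]
        exact (hl.inv.mul haff).mul hl
      · intro w hw
        rw [hconj] at hw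
        have h1 : φ * elem z 1 * φ⁻¹ = l * trans w * l⁻¹ := by
          rw [← hw]
          group
        have h2 := hl.inv.inv_mul_trans_mul w
        rw [inv_inv, ← h1] at h2
        exact htr _ h2
      · rw [hconj]
        have := hcomm.map (MulAut.conj l⁻¹)
        simp only [MulAut.conj_apply, inv_inv] at this
        rwa [hlv] at this
      · rw [hconj, AlgEquiv.mul_apply, AlgEquiv.mul_apply]
        simp only [hll]
        rw [hinv]

/-- A translation degenerate automorphism, that is, one that conjugates some nontrivial
translation to an affine automorphism, is affine or generates a nonaffine elementary automorphism
together with the affine automorphisms. -/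
theorem isAff_of_isAff_conj_trans (hn : 3 ≤ n) (hA : ∀ α, IsAff α → α ∈ H)
    (hE : ∀ (z : Fin n) (h : without K z), elem z h ∈ H →
      (h : MvPolynomial (Fin n) K) ∈ affineFns n K)
    {v : Fin n → K} (hv : v ≠ 0) {φ : Aut n K} (hφ : φ ∈ H)
    (haff : IsAff (φ * trans v * φ⁻¹)) : IsAff φ := by
  let z : Fin n := ⟨n - 1, by omega⟩
  obtain ⟨l, hl, hlv⟩ := exists_conj_trans z hv
  rw [← hl.mul_right_iff]
  refine isAff_of_isAff_conj_elem hn hA hE (z := z) (by simp [z]; omega)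
    (mul_mem hφ (hA _ hl)) ?_
  have : φ * l * elem z 1 * (φ * l)⁻¹ = φ * trans v * φ⁻¹ := by
    rw [← hlv]
    group
  rwa [this]

end

/-! ### Triangular automorphisms -/

theorem IsTri.map_mem {τ : Aut n K} (h : IsTri τ) {i : Fin n} {P : MvPolynomial (Fin n) K}
    (hP : P ∈ supported K (Set.Iio i)) : τ P ∈ supported K (Set.Iio i) := by
  refine map_supported_mem (τ : MvPolynomial (Fin n) K →ₐ[K] MvPolynomial (Fin n) K) _
    (fun j hj => ?_) hP
  obtain ⟨u, Q, hQ, hu⟩ := h j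
  rw [AlgEquiv.coe_toAlgHom, hu]
  exact add_mem (mul_mem (Subalgebra.algebraMap_mem _ _) (X_mem_supported.mpr hj))
    (supported_mono (Set.Iio_subset_Iio (le_of_lt hj)) hQ)

theorem IsTri.inv {τ : Aut n K} (h : IsTri τ) : IsTri τ⁻¹ := by
  have hτ : ∀ P, τ⁻¹ (τ P) = P := fun P => by
    rw [← AlgEquiv.mul_apply, inv_mul_cancel, AlgEquiv.one_apply]
  have key : ∀ i, ∃ u : Kˣ, ∃ P, τ⁻¹ (X i) = C (u : K) * X i - C (u : K) * τ⁻¹ P ∧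
      P ∈ supported K (Set.Iio i) := by
    intro i
    obtain ⟨u, P, hP, hu⟩ := h i
    refine ⟨u⁻¹, P, ?_, hP⟩
    have h1 : τ⁻¹ (τ (X i)) = τ⁻¹ (C (u : K) * X i + P) := by rw [hu]
    rw [hτ, map_add, map_mul, algEquiv_C] at h1
    have h2 : (C ((u⁻¹ : Kˣ) : K) * C (u : K) : MvPolynomial (Fin n) K) = 1 := by
      rw [← C_mul, ← Units.val_mul, inv_mul_cancel, Units.val_one, C_1]
    linear_combination (-τ⁻¹ (X i)) * h2 - C ((u⁻¹ : Kˣ) : K) * h1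
  have hmem : ∀ i : Fin n, τ⁻¹ (X i) ∈ supported K (Set.Iic i) := by
    intro i
    induction i using WellFoundedLT.induction with
    | _ i ih =>
      obtain ⟨u, P, hu, hP⟩ := key i
      rw [hu]
      refine sub_mem (mul_mem (Subalgebra.algebraMap_mem _ _)
        (X_mem_supported.mpr Set.self_mem_Iic)) (mul_mem (Subalgebra.algebraMap_mem _ _) ?_)
      exact map_supported_mem (S := supported K _)
        (f := ((τ⁻¹ : Aut n K) : MvPolynomial (Fin n) K →ₐ[K] MvPolynomial (Fin n) K)) (fun j hj =>
        supported_mono (Set.Iic_subset_Iic.mpr (le_of_lt hj)) (ih j hj)) hP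
  intro i
  obtain ⟨u, P, hu, hP⟩ := key i
  refine ⟨u, -(C (u : K) * τ⁻¹ P), ?_, by rw [hu, sub_eq_add_neg]⟩
  refine neg_mem (mul_mem (Subalgebra.algebraMap_mem _ _) ?_)
  exact map_supported_mem (S := supported K _)
        (f := ((τ⁻¹ : Aut n K) : MvPolynomial (Fin n) K →ₐ[K] MvPolynomial (Fin n) K)) (fun j hj =>
    supported_mono (fun m (hm : m ≤ j) => lt_of_le_of_lt hm hj) (hmem j)) hP

/-- An automorphism is unitriangular if it changes each variable by a polynomial in the previous
variables. -/
def IsUnitri (σ : Aut n K) : Prop := ∀ i, σ (X i) - X i ∈ supported K (Set.Iio i)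

theorem IsUnitri.isTri {σ : Aut n K} (h : IsUnitri σ) : IsTri σ :=
  fun i => ⟨1, _, h i, by simp⟩

theorem IsUnitri.mul {σ τ : Aut n K} (h : IsUnitri σ) (h' : IsUnitri τ) : IsUnitri (σ * τ) := by
  intro i
  have : (σ * τ) (X i) - X i = σ (τ (X i) - X i) + (σ (X i) - X i) := by
    rw [AlgEquiv.mul_apply, map_sub]
    ring
  rw [this]
  exact add_mem (h.isTri.map_mem (h' i)) (h i)

theorem IsUnitri.inv {σ : Aut n K} (h : IsUnitri σ) : IsUnitri σ⁻¹ := by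
  intro i
  have : σ⁻¹ (X i) - X i = -σ⁻¹ (σ (X i) - X i) := by
    rw [map_sub, ← AlgEquiv.mul_apply, inv_mul_cancel, AlgEquiv.one_apply]
    ring
  rw [this]
  exact neg_mem (h.isTri.inv.map_mem (h i))

theorem isUnitri_trans (v : Fin n → K) : IsUnitri (trans v) := fun i => by
  rw [trans_X, add_sub_cancel_left]
  exact Subalgebra.algebraMap_mem _ _

theorem IsTri.isUnitri_conj {τ σ : Aut n K} (hτ : IsTri τ) (hσ : IsUnitri σ) :
    IsUnitri (τ * σ * τ⁻¹) := by
  intro i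
  obtain ⟨u, Q, hQ, hu⟩ := hτ.inv i
  have h1 : X i = C (u : K) * τ (X i) + τ Q := by
    have := congrArg τ hu
    rwa [← AlgEquiv.mul_apply, mul_inv_cancel, AlgEquiv.one_apply, map_add, map_mul,
      algEquiv_C] at this
  have h2 : (τ * σ * τ⁻¹) (X i) - X i =
      C (u : K) * τ (σ (X i) - X i) + τ (σ Q) - τ Q := by
    rw [AlgEquiv.mul_apply, AlgEquiv.mul_apply, hu]
    simp only [map_add, map_mul, algEquiv_C, map_sub]
    linear_combination -h1
  rw [h2]
  exact sub_mem (add_mem (mul_mem (Subalgebra.algebraMap_mem _ _) (hτ.map_mem (hσ i)))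
    (hτ.map_mem (hσ.isTri.map_mem hQ))) (hτ.map_mem hQ)

/-! ### Iterated commutators with a translation -/

/-- The commutator with a fixed element. -/
def comm {G : Type*} [Group G] (t σ : G) : G := σ * t * σ⁻¹ * t⁻¹

theorem comm_iterate_conj {G : Type*} [Group G] (g t σ : G) (k : ℕ) :
    (comm (g * t * g⁻¹))^[k] (g * σ * g⁻¹) = g * (comm t)^[k] σ * g⁻¹ := by
  induction k generalizing σ with
  | zero => rfl
  | succ k ih =>
    rw [Function.iterate_succ_apply, Function.iterate_succ_apply, ← ih]
    congr 1
    unfold comm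
    group

/-- If `σ` fixes the variables before `x_z` and adds `c` to `x_z`, its commutator with the
translation adds `c - trans q c` instead. So each commutator applies the locally nilpotent
difference operator to `c`, up to sign. -/
theorem exists_comm_iterate_fixes (q : Fin n → K) (z : Fin n) (N : ℕ) :
    ∀ σ : Aut n K, IsUnitri σ → (∀ i < z, σ (X i) = X i) →
      (diff (trans q) ^ N) (σ (X z) - X z) = 0 →
      ∃ k, IsUnitri ((comm (trans q))^[k] σ) ∧ ∀ i ≤ z, (comm (trans q))^[k] σ (X i) = X i := by
  induction N with
  | zero =>
    intro σ h1 h2 h3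
    refine ⟨0, h1, fun i hi => ?_⟩
    rcases eq_or_lt_of_le hi with rfl | hi
    · exact sub_eq_zero.mp h3
    · exact h2 i hi
  | succ N ih =>
    intro σ h1 h2 h3
    have hfix : ∀ P ∈ supported K (Set.Iio z), σ P = P := fun P hP =>
      eqOn_supported (σ : MvPolynomial (Fin n) K →ₐ[K] MvPolynomial (Fin n) K)
        (AlgHom.id K _) h2 hP
    have hfix' : ∀ P ∈ supported K (Set.Iio z), σ⁻¹ P = P := fun P hP => by
      nth_rewrite 1 [← hfix P hP]
      rw [← AlgEquiv.mul_apply, inv_mul_cancel, AlgEquiv.one_apply]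
    have ht : ∀ i, (trans q)⁻¹ (X i) = X i - C (q i) := fun i => by
      apply (trans q).injective
      rw [← AlgEquiv.mul_apply, mul_inv_cancel, AlgEquiv.one_apply, map_sub, trans_X, algEquiv_C]
      ring
    obtain ⟨c, hc, hσ⟩ : ∃ c ∈ supported K (Set.Iio z), σ (X z) = X z + c :=
      ⟨_, h1 z, by ring⟩
    have hσ' : σ⁻¹ (X z) = X z - c := by
      apply σ.injective
      rw [← AlgEquiv.mul_apply, mul_inv_cancel, AlgEquiv.one_apply, map_sub, hfix c hc, hσ]
      ring
    have htc : trans q c ∈ supported K (Set.Iio z) := (isUnitri_trans q).isTri.map_mem hc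
    have hz : comm (trans q) σ (X z) = X z + c - trans q c := by
      simp only [comm, AlgEquiv.mul_apply, ht, map_sub, hσ', algEquiv_C, trans_X, map_add, hσ,
        hfix _ htc]
      ring
    obtain ⟨k, hk⟩ := ih (comm (trans q) σ)
      (((h1.mul (isUnitri_trans q)).mul h1.inv).mul (isUnitri_trans q).inv)
      (fun i hi => by
        simp only [comm, AlgEquiv.mul_apply, ht, map_sub, hfix' _ (X_mem_supported.mpr hi),
          algEquiv_C, trans_X, map_add, h2 i hi]
        ring) (by
        have e : comm (trans q) σ (X z) - X z = -diff (trans q) c := by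
          rw [hz, diff_apply]
          ring
        rw [hσ, add_sub_cancel_left, pow_succ, Module.End.mul_apply] at h3
        rw [e, map_neg, h3, neg_zero])
    exact ⟨k + 1, by simpa only [Function.iterate_succ_apply] using hk⟩

/-- Iterated commutators of a unitriangular automorphism with a translation become trivial. -/
theorem exists_comm_iterate_eq_one (q : Fin n → K) (m : ℕ) :
    ∀ j : ℕ, n = j + m → ∀ σ : Aut n K, IsUnitri σ → (∀ i : Fin n, (i : ℕ) < j → σ (X i) = X i) →
      ∃ k, (comm (trans q))^[k] σ = 1 := by
  induction m with
  | zero =>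
    intro j hj σ _ h
    exact ⟨0, algEquiv_ext fun i => h i (by omega)⟩
  | succ m ih =>
    intro j hj σ h1 h2
    let z : Fin n := ⟨j, by omega⟩
    obtain ⟨N, hN⟩ := exists_diff_trans_pow_eq_zero q (σ (X z) - X z)
    obtain ⟨k, hk1, hk2⟩ := exists_comm_iterate_fixes q z N σ h1 (fun i hi => h2 i hi) hN
    obtain ⟨k', hk'⟩ := ih (j + 1) (by omega) _ hk1
      (fun i hi => hk2 i (Fin.le_def.mpr (Nat.lt_succ_iff.mp hi)))
    exact ⟨k' + k, by rw [Function.iterate_add_apply, hk']⟩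

/-- No polynomial `P_i` of a triangular automorphism involves the last variable, so the translation
along it is merely rescaled. -/
theorem IsTri.exists_trans {τ : Aut n K} (h : IsTri τ) {z : Fin n} (hz : (z : ℕ) + 1 = n) :
    ∃ v, v ≠ 0 ∧ τ⁻¹ * elem z 1 * τ = trans v := by
  obtain ⟨u, -, -, -⟩ := id (h z)
  have h1 : ∃ v, τ⁻¹ * elem z 1 * τ = trans v := by
    choose u P hP hu using h
    refine ⟨Pi.single z (u z : K), ?_⟩
    rw [mul_assoc, inv_mul_eq_iff_eq_mul]
    refine algEquiv_ext fun i => ?_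
    have hPz : P i ∈ without K z := supported_mono (fun j (hj : j < i) => by
      rintro rfl
      have : (j : ℕ) < i := hj
      omega) (hP i)
    rw [AlgEquiv.mul_apply, AlgEquiv.mul_apply, trans_X, map_add, algEquiv_C, hu, map_add, map_mul,
      algEquiv_C, elem_of_mem _ hPz]
    rcases eq_or_ne i z with rfl | hi
    · rw [elem_X_self, Pi.single_eq_same]
      push_cast
      ring
    · rw [elem_X_of_ne hi, Pi.single_eq_of_ne hi, C_0, add_zero]
  obtain ⟨v, hv⟩ := h1
  refine ⟨v, ?_, hv⟩
  rintro rfl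
  rw [trans_zero, mul_assoc, inv_mul_eq_one, eq_comm, mul_eq_right, elem_one_eq_trans,
    ← trans_zero] at hv
  have := congrFun (trans_injective hv) z
  simp at this

/-- Degree zero cannot occur, because an automorphism sends no variable to a constant. -/
theorem isAffine_iff {φ : GA n K} : φ.IsAffine ↔ IsAff φ.unop := by
  refine forall_congr' fun i => ?_
  rw [mem_restrictTotalDegree]
  refine ⟨fun h => h.le, fun h => le_antisymm h (Nat.one_le_iff_ne_zero.mpr ?_)⟩
  refine totalDegree_ne_zero fun c hc => ?_
  have h1 := congrArg totalDegree ((map_eq_C_iff φ.unop).mp hc)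
  simp at h1

/-! ### Products of three triangular automorphisms -/

variable [CharZero K] {H : Subgroup (Aut n K)}

/-- If the commutator of `ρ` with the translation is affine, then `ρ` conjugates that translation to
an affine automorphism, so `ρ` is affine. Affineness thus climbs back along the chain of
commutators. -/
theorem isAff_of_comm_iterate_eq_one (hn : 3 ≤ n) (hA : ∀ α, IsAff α → α ∈ H)
    (hE : ∀ (z : Fin n) (h : without K z), elem z h ∈ H →
      (h : MvPolynomial (Fin n) K) ∈ affineFns n K)
    {y : Fin n → K} (hy : y ≠ 0) (k : ℕ) :
    ∀ ρ ∈ H, (comm (trans y))^[k] ρ = 1 → IsAff ρ := by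
  induction k with
  | zero =>
    rintro ρ - h
    rw [Function.iterate_zero_apply] at h
    rw [h]
    exact isAff_one
  | succ k ih =>
    intro ρ hρ h
    have ht := hA _ (isAff_trans y)
    have h1 := ih (comm (trans y) ρ) (mul_mem (mul_mem (mul_mem hρ ht) (inv_mem hρ)) (inv_mem ht)) h
    refine isAff_of_isAff_conj_trans hn hA hE hy hρ ?_
    simpa [comm] using h1.mul (isAff_trans y)

/-- The conjugate of `trans v` by the product is the conjugate by `τ₁ α₁` of a unitriangular
automorphism. The same `τ₁ α₁` carries `trans q` to `trans y`, so the trivial iterated commutator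
with `trans q` becomes one with a genuine translation. -/
theorem isAff_of_three_triangular (hn : 3 ≤ n) (hA : ∀ α, IsAff α → α ∈ H)
    (hE : ∀ (z : Fin n) (h : without K z), elem z h ∈ H →
      (h : MvPolynomial (Fin n) K) ∈ affineFns n K)
    {τ₁ τ₂ τ₃ α₁ α₂ : Aut n K} (h₁ : IsTri τ₁) (h₂ : IsTri τ₂) (h₃ : IsTri τ₃)
    (hα₁ : IsAff α₁) (hα₂ : IsAff α₂) (hψ : τ₁ * α₁ * τ₂ * α₂ * τ₃ ∈ H) :
    IsAff (τ₁ * α₁ * τ₂ * α₂ * τ₃) := by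
  let z : Fin n := ⟨n - 1, by omega⟩
  have hz : (z : ℕ) + 1 = n := by
    simp only [z]
    omega
  obtain ⟨v, hv0, hv⟩ := h₃.exists_trans hz
  obtain ⟨y, hy0, hy⟩ := h₁.inv.exists_trans hz
  rw [inv_inv] at hy
  have hw := hα₂.inv.inv_mul_trans_mul (Pi.single z 1)
  rw [inv_inv, ← elem_one_eq_trans] at hw
  have hq := hα₁.inv_mul_trans_mul (Pi.single z 1)
  rw [← elem_one_eq_trans] at hq
  refine isAff_of_isAff_conj_trans hn hA hE hv0 hψ ?_
  set w : Fin n → K := fun i => dirDeriv (Pi.single z 1) (α₂⁻¹ (X i))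
  set q : Fin n → K := fun i => dirDeriv (Pi.single z 1) (α₁ (X i))
  obtain ⟨k, hk⟩ := exists_comm_iterate_eq_one q n 0 (by omega) _
    (h₂.isUnitri_conj (isUnitri_trans w)) (fun i hi => absurd hi (by omega))
  have e1 : τ₁ * α₁ * τ₂ * α₂ * τ₃ * trans v * (τ₁ * α₁ * τ₂ * α₂ * τ₃)⁻¹ =
      τ₁ * α₁ * (τ₂ * trans w * τ₂⁻¹) * (τ₁ * α₁)⁻¹ := by
    rw [← hv, ← hw]
    group
  have e2 : trans y = τ₁ * α₁ * trans q * (τ₁ * α₁)⁻¹ := by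
    rw [← hy, ← hq]
    group
  refine isAff_of_comm_iterate_eq_one hn hA hE hy0 k _
    (mul_mem (mul_mem hψ (hA _ (isAff_trans v))) (inv_mem hψ)) ?_
  rw [e1, e2, comm_iterate_conj, hk]
  group

/-- A 3-triangular automorphism of affine `n`-space, `n ≥ 3`, is affine or co-tame. -/
theorem isAffine_or_isCotame (hn : 3 ≤ n) (φ : GA n K) (hφ : φ.IsMTriangular 3) :
    φ.IsAffine ∨ φ.IsCotame := by
  let H := (Subgroup.closure (insert φ {α : GA n K | α.IsAffine})).unop
  have hA : ∀ α, IsAff α → α ∈ H := fun α hα => Subgroup.mem_unop.mpr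
    (Subgroup.subset_closure (Or.inr (isAffine_iff.mpr hα)))
  have hφH : φ.unop ∈ H := Subgroup.mem_unop.mpr (Subgroup.subset_closure (Or.inl rfl))
  by_cases hE : ∀ (z : Fin n) (h : without K z), elem z h ∈ H →
      (h : MvPolynomial (Fin n) K) ∈ affineFns n K
  · left
    obtain ⟨α, τ, hα, hτ, rfl⟩ := hφ
    simp only [isAffine_iff] at hα
    rw [isAffine_iff]
    simp only [List.ofFn_succ, List.ofFn_zero, List.prod_cons, List.prod_nil, mul_one,
      MulOpposite.unop_mul] at hφH ⊢
    rw [(hα 0).mul_right_iff]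
    have h1 := mul_mem hφH (inv_mem (hA _ (hα 0)))
    rw [mul_inv_cancel_right] at h1
    simp only [mul_assoc] at h1 ⊢
    rw [(hα _).mul_left_iff]
    have h2 := mul_mem (inv_mem (hA _ (hα (Fin.succ (0 : Fin 1)).succ.succ))) h1
    rw [inv_mul_cancel_left] at h2
    -- Passing from the opposite group to algebra automorphisms reverses the order of the factors.
    have h3 := isAff_of_three_triangular hn hA hE (hτ 2) (hτ 1) (hτ 0) (hα 2) (hα 1)
      (by simp only [mul_assoc]; exact h2)
    simp only [mul_assoc] at h3
    exact h3
  · right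
    push Not at hE
    obtain ⟨z, h, hh, hdeg⟩ := hE
    refine (Subgroup.closure_le _).mpr ?_
    rintro τ (hτ | hτ)
    · exact Subgroup.subset_closure (Or.inr hτ)
    · exact Subgroup.mem_unop.mp (isTri_mem_of_elem_mem hA hn hh hdeg (τ := τ.unop) hτ)

end

end PolyAut

theorem theorem1p1 {n : ℕ} (hn : 3 ≤ n) {K : Type*} [Field K] [CharZero K]
    (φ : GA n K) (hφ : φ.IsMTriangular 3) :
    φ.IsAffine ∨ φ.IsCotame :=
  PolyAut.isAffine_or_isCotame hn φ hφ
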